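/- Write $\mathbb{R}_+=[0,\infty)$ with Lebesgue measure, and use the following notions. - A function $f\in L^2(\mathbb{R}_+^n)$ (complex-valued) is mirror symmetric if $f(t_1,\dots,t_n)=\overline{f(t_n,\dots,t_1)}$ for almost all $t_1,\dots,t_n$. - For $f\in L^2(\mathbb{R}_+^n)$, $g\in L^2(\mathbb{R}_+^m)$ and $p\le\min\{n,m\}$, the $p$-th contraction is $$f\overset{p}{\frown}g\,(t_1,\dots,t_{n+m-2p})=\int_{\mathbb{R}_+^p}f(t_1,\dots,t_{n-p},s_1,\dots,s_p)\,g(s_p,\dots,s_1,t_{n-p+1},\dots,t_{n+m-2p})\,ds_1\cdots ds_p.$$ - For positive integers $m_1,\dots,m_r$ with sum $m$, $m_1\otimes\cdots\otimes m_r$ denotes the partition of $\{1,\dots,m\}$ into the consecutive intervals $B_1,\dots,B_r$ of lengths $m_1,\dots,m_r$. A pairing $\pi$ of $\{1,\dots,m\}$ (a partition into two-element blocks) is non-crossing if there are no two distinct blocks $\{x_1,y_1\},\{x_2,y_2\}\in\pi$ with $x_1<x_2<y_1<y_2$. It respects $m_1\otimes\cdots\otimes m_r$ if no block of $\pi$ contains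 two elements of the same $B_j$. It is connected if the graph with vertices $B_1,\dots,B_r$, in which $B_j$ and $B_l$ are joined whenever some $\{x,y\}\in\pi$ has $x\in B_j$ and $y\in B_l$, is connected. $NC_2^c(m_1\otimes\cdots\otimes m_r)$ is the set of non-crossing pairings that respect $m_1\otimes\cdots\otimes m_r$ and are connected. - For a pairing $\pi$ of $\{1,\dots,m\}$ and $f:\mathbb{R}_+^m\to\mathbb{C}$, the pairing integral is $\int_\pi f=\int f(t_1,\dots,t_m)\prod_{\{x,y\}\in\pi}\delta(t_x-t_y)\,dt_1\cdots dt_m$; that is, the two variables of each block of $\pi$ are identified and one integrates over one variable in $\mathbb{R}_+$ per block. **Proposition.** Let $d\ge2$ and let $n_1,\dots,n_d$ be fixed positive integers. For each $i=1,\dots,d$ let $(f_k^{(i)})_{k\in\mathbb{N}}$ be a sequence of mirror-symmetric functions in $L^2(\mathbb{R}_+^{n_i})$ such that - there is a constant $M>0$ with $\|f_k^{(i)}\|_{L^2(\mathbb{R}_+^{n_i})}\le M$ for all $k\in\mathbb{N}$ and all $i=1,\dots,d$; - for all $i=1,\dots,d$ and all $p=1,\dots,n_i-1$, $\ \lim_{k\to\infty}f_k^{(i)}\overset{p}{\frown}f_k^{(i)}=0$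 in $L^2(\mathbb{R}_+^{2n_i-2p})$. Let $r\ge3$, let $i_1,\dots,i_r\in\{1,\dots,d\}$, and let $\pi\in NC_2^c(n_{i_1}\otimes\cdots\otimes n_{i_r})$. Then the pairing integrals $\int_\pi f_k^{(i_1)}\otimes\cdots\otimes f_k^{(i_r)}$ exist (they converge absolutely) for every $k$, and $$\lim_{k\to\infty}\int_\pi f_k^{(i_1)}\otimes\cdots\otimes f_k^{(i_r)}=0.$$ -/

import Mathlib

open MeasureTheory Filter Topology
open scoped NNReal ENNReal

namespace WignerChaos

/-- Lebesgue measure on the half-line `ℝ₊ = [0, ∞)`. The measure `volume` on `ℝ₊ⁿ` is then the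
product Lebesgue measure. -/
noncomputable instance instMeasureSpaceNNReal : MeasureSpace ℝ≥0 where
  volume := Measure.comap ((↑) : ℝ≥0 → ℝ) volume

instance instSigmaFiniteNNReal : SigmaFinite (volume : Measure ℝ≥0) := by
  have : IsFiniteMeasureOnCompacts (volume : Measure ℝ≥0) :=
    .comap' (volume : Measure ℝ) NNReal.continuous_coe
      (MeasurableEmbedding.subtype_coe (s := Set.Ici (0 : ℝ)) measurableSet_Ici)
  infer_instance

/-- A complex function `f` on `ℝ₊ⁿ` is mirror symmetric if
`f (t₁, …, tₙ) = conj (f (tₙ, …, t₁))` for Lebesgue-almost every `(t₁, …, tₙ)`. -/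
def MirrorSymmetric {n : ℕ} (f : (Fin n → ℝ≥0) → ℂ) : Prop :=
  ∀ᵐ t : Fin n → ℝ≥0, f t = starRingEnd ℂ (f (fun j => t j.rev))

/-- The `p`-th contraction of `f` and `g`, for `p ≤ min n m`:
`(t₁, …, t_{n+m-2p}) ↦ ∫ f (t₁, …, t_{n-p}, s₁, …, s_p) g (s_p, …, s₁, t_{n-p+1}, …, t_{n+m-2p}) ds`,
the integral being over `s ∈ ℝ₊ᵖ`. -/
noncomputable def contraction {n m : ℕ} (p : ℕ) (hn : p ≤ n) (hm : p ≤ m)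
    (f : (Fin n → ℝ≥0) → ℂ) (g : (Fin m → ℝ≥0) → ℂ) :
    (Fin ((n - p) + (m - p)) → ℝ≥0) → ℂ :=
  fun t => ∫ s : Fin p → ℝ≥0,
    f (Fin.append (fun a : Fin (n - p) => t (Fin.castAdd (m - p) a)) s ∘
        Fin.cast (Nat.sub_add_cancel hn).symm) *
    g (Fin.append (fun a : Fin p => s a.rev) (fun b : Fin (m - p) => t (Fin.natAdd (n - p) b)) ∘
        Fin.cast (Nat.add_sub_cancel' hm).symm)

/-- The tensor product `g₁ ⊗ ⋯ ⊗ g_r`, a function of `m₁ + ⋯ + m_r` variables: `finSigmaFinEquiv`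
sends `⟨j, a⟩` to the position `m₁ + ⋯ + m_{j-1} + a`. -/
def tensor {r : ℕ} {m : Fin r → ℕ} (g : ∀ j, (Fin (m j) → ℝ≥0) → ℂ) :
    (Fin (∑ j, m j) → ℝ≥0) → ℂ :=
  fun t => ∏ j, g j (fun a => t (finSigmaFinEquiv ⟨j, a⟩))

/-- A partition all of whose blocks have exactly two elements. -/
def IsPairing {n : ℕ} (π : Finpartition (Finset.univ : Finset (Fin n))) : Prop :=
  ∀ B ∈ π.parts, B.card = 2

/-- No two distinct blocks `B₁`, `B₂` contain `x₁, y₁ ∈ B₁` and `x₂, y₂ ∈ B₂` such that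
`x₁ < x₂ < y₁ < y₂`. -/
def NonCrossing {n : ℕ} (π : Finpartition (Finset.univ : Finset (Fin n))) : Prop :=
  ∀ B₁ ∈ π.parts, ∀ B₂ ∈ π.parts, B₁ ≠ B₂ →
    ¬ ∃ x₁ ∈ B₁, ∃ y₁ ∈ B₁, ∃ x₂ ∈ B₂, ∃ y₂ ∈ B₂, x₁ < x₂ ∧ x₂ < y₁ ∧ y₁ < y₂

/-- The `j`-th block of the interval partition `m₁ ⊗ ⋯ ⊗ m_r`: the first block consists of the
first `m₁` positions, the second block of the following `m₂` positions, and so on. -/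
def tensorBlock {r : ℕ} (m : Fin r → ℕ) (j : Fin r) : Finset (Fin (∑ j, m j)) :=
  Finset.univ.image fun a : Fin (m j) => finSigmaFinEquiv ⟨j, a⟩

/-- `π` respects `m₁ ⊗ ⋯ ⊗ m_r`: no block of `π` contains more than one element of any block
of `m₁ ⊗ ⋯ ⊗ m_r`. -/
def Respects {r : ℕ} (m : Fin r → ℕ)
    (π : Finpartition (Finset.univ : Finset (Fin (∑ j, m j)))) : Prop :=
  ∀ B ∈ π.parts, ∀ j, (B ∩ tensorBlock m j).card ≤ 1

/-- `π` links the `j`-th and the `l`-th block of `m₁ ⊗ ⋯ ⊗ m_r`. -/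
def Links {r : ℕ} (m : Fin r → ℕ)
    (π : Finpartition (Finset.univ : Finset (Fin (∑ j, m j)))) (j l : Fin r) : Prop :=
  ∃ x ∈ tensorBlock m j, ∃ y ∈ tensorBlock m l, ({x, y} : Finset (Fin (∑ j, m j))) ∈ π.parts

/-- The graph whose vertices are the blocks of `m₁ ⊗ ⋯ ⊗ m_r` (represented by their indices),
with an edge between two distinct blocks if and only if `π` links them. -/
def linkGraph {r : ℕ} (m : Fin r → ℕ)
    (π : Finpartition (Finset.univ : Finset (Fin (∑ j, m j)))) : SimpleGraph (Fin r) :=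
  SimpleGraph.fromRel (Links m π)

/-- `π ∈ NC₂ᶜ(m₁ ⊗ ⋯ ⊗ m_r)`: the non-crossing pairings that respect and connect
`m₁ ⊗ ⋯ ⊗ m_r`. -/
structure IsConnectedNCPairing {r : ℕ} (m : Fin r → ℕ)
    (π : Finpartition (Finset.univ : Finset (Fin (∑ j, m j)))) : Prop where
  pairing : IsPairing π
  nonCrossing : NonCrossing π
  respects : Respects m π
  connected : (linkGraph m π).Connected

/-- The point of `ℝ₊ⁿ` whose `i`-th coordinate is the variable attached to the block of `π`
containing `i`. -/
def diagonalPoint {n : ℕ} (π : Finpartition (Finset.univ : Finset (Fin n)))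
    (s : π.parts → ℝ≥0) : Fin n → ℝ≥0 :=
  fun i => s ⟨π.part i, π.part_mem.2 (Finset.mem_univ i)⟩

/-- The pairing integral `∫ f (t₁, …, tₙ) ∏_{{i,j} ∈ π} δ(t_i - t_j) dt₁ ⋯ dtₙ` exists: after the
delta functions are integrated out (the two variables of each block are identified), what remains
is an absolutely convergent Lebesgue integral with one variable for each block of `π`. -/
def PairingIntegrable {n : ℕ} (π : Finpartition (Finset.univ : Finset (Fin n)))
    (f : (Fin n → ℝ≥0) → ℂ) : Prop :=
  Integrable (fun s : π.parts → ℝ≥0 => f (diagonalPoint π s)) volume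

/-- The pairing integral `∫ f (t₁, …, tₙ) ∏_{{i,j} ∈ π} δ(t_i - t_j) dt₁ ⋯ dtₙ`. -/
noncomputable def pairingIntegral {n : ℕ} (π : Finpartition (Finset.univ : Finset (Fin n)))
    (f : (Fin n → ℝ≥0) → ℂ) : ℂ :=
  ∫ s : π.parts → ℝ≥0, f (diagonalPoint π s)

end WignerChaos

/-! The variables of the pairing integral are the blocks of `π`, and each occurs in exactly two of
the factors. Cauchy–Schwarz in one variable after another therefore bounds the integral of the
absolute value by the product of the `L²` norms; this gives convergence
(`lintegral_prod_le_of_paired`).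

For the limit, non-crossing produces two neighbouring factors `f`, `g` joined by `p ≥ 1` nested
pairs, which are all the pairs between them. By connectedness and `r ≥ 3` these pairs cannot exhaust
both factors (`exists_nested`). Integrating over the `p` shared variables replaces `f` and `g` by
their `p`-th contraction. Every remaining variable still occurs in exactly two factors, so the
integral is at most the norm of this contraction times the norms of the other factors
(`enorm_integral_prod_le`).

It remains to see that the mixed contraction tends to zero. Read `f` and `g` as Hilbert–Schmidt
kernels `A` and `B`, so that the contraction is their composition. Expanding the square bounds its
squared norm by the norm of the Gram kernel of `A` times `‖B‖²`. By mirror symmetry the Gram kernel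
of `A` is, up to reversing variables, the contraction of `f` with itself of the complementary order
`a = n - p`. If `a ≥ 1` the hypothesis applies to it; otherwise `g` has variables left over and
plays the same role. -/

/-! ### Cauchy–Schwarz for products in which each variable is shared by two factors. -/

section PairedProducts

variable {X : Type*} [MeasureSpace X]

/-- Splitting the coordinates of a point of `V → X` along an equivalence `ι ⊕ κ ≃ V`. -/
def piSplit {ι κ V : Type*} (X : Type*) [MeasurableSpace X] (e : ι ⊕ κ ≃ V) :
    (V → X) ≃ᵐ (ι → X) × (κ → X) :=
  (MeasurableEquiv.piCongrLeft (fun _ => X) e).symm.trans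
    (MeasurableEquiv.sumPiEquivProdPi fun _ => X)

theorem piSplit_apply {ι κ V : Type*} (e : ι ⊕ κ ≃ V) (x : V → X) :
    piSplit X e x = (fun a => x (e (.inl a)), fun b => x (e (.inr b))) := rfl

theorem piSplit_symm_inl {ι κ V : Type*} (e : ι ⊕ κ ≃ V) (z : (ι → X) × (κ → X)) (a : ι) :
    (piSplit X e).symm z (e (.inl a)) = z.1 a := by
  conv_rhs => rw [← (piSplit X e).apply_symm_apply z]
  rfl

theorem piSplit_symm_inr {ι κ V : Type*} (e : ι ⊕ κ ≃ V) (z : (ι → X) × (κ → X)) (b : κ) :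
    (piSplit X e).symm z (e (.inr b)) = z.2 b := by
  conv_rhs => rw [← (piSplit X e).apply_symm_apply z]
  rfl

variable [SigmaFinite (volume : Measure X)]

theorem measurePreserving_piSplit {ι κ V : Type*} [Fintype ι] [Fintype κ] [Fintype V]
    (e : ι ⊕ κ ≃ V) : MeasurePreserving (piSplit X e) volume volume :=
  (volume_measurePreserving_sumPiEquivProdPi fun _ => X).comp
    (volume_measurePreserving_piCongrLeft (fun _ => X) e).symm

/-- Restricting points of `V → X` to an injective family of coordinates is quasi measure
preserving. -/
theorem quasiMeasurePreserving_comp_injective {ι V : Type*} [Fintype ι] [Fintype V]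
    {φ : ι → V} (hφ : Function.Injective φ) :
    Measure.QuasiMeasurePreserving (fun (x : V → X) (a : ι) => x (φ a)) volume volume := by
  classical
  let e : ι ⊕ {v // v ∉ Set.range φ} ≃ V :=
    ((Equiv.ofInjective φ hφ).sumCongr (Equiv.refl _)).trans (Equiv.sumCompl (· ∈ Set.range φ))
  exact Measure.quasiMeasurePreserving_fst.comp
    (measurePreserving_piSplit e).quasiMeasurePreserving

theorem prod_eq_mul_mul_prod_erase {J M : Type*} [Fintype J] [DecidableEq J] [CommMonoid M]
    (h : J → M) {a b : J} (hab : a ≠ b) :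
    ∏ j, h j = h a * h b * ∏ j ∈ (Finset.univ.erase a).erase b, h j := by
  rw [mul_assoc, Finset.mul_prod_erase _ _ (by simp [hab.symm]),
    Finset.mul_prod_erase _ _ (Finset.mem_univ a)]

variable {J V : Type*} [Fintype J] {ι : J → Type*} [∀ j, Fintype (ι j)]

/-- Induction on the set `s` of variables already integrated. A new variable enters exactly two
factors, so Cauchy–Schwarz in that variable splits them and the others are constants. Partial
integrals are needed for the induction; `s = univ` gives the full `L²` norms. -/
theorem lmarginal_prod_le [DecidableEq V] [∀ j, DecidableEq (ι j)] {φ : ∀ j, ι j → V}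
    (hφ : ∀ j, Function.Injective (φ j))
    (hpair : ∀ v, ∃ a b, a ≠ b ∧ ∀ j, v ∈ Set.range (φ j) ↔ j = a ∨ j = b)
    {F : ∀ j, (ι j → X) → ℝ≥0∞} (hF : ∀ j, Measurable (F j)) (s : Finset V) (x : V → X) :
    (∫⋯∫⁻_s, (fun x => ∏ j, F j (fun a => x (φ j a))) ∂(fun _ => volume)) x ≤
      ∏ j, ((∫⋯∫⁻_(Finset.univ.filter fun a => φ j a ∈ s), (fun y => F j y ^ 2)
        ∂(fun _ => volume)) (fun a => x (φ j a))) ^ (1 / 2 : ℝ) := by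
  classical
  induction s using Finset.induction_on generalizing x with
  | empty =>
    simp only [Finset.notMem_empty, Finset.filter_false, lmarginal_empty]
    refine Finset.prod_le_prod' fun j _ => ?_
    rw [← ENNReal.rpow_natCast, ← ENNReal.rpow_mul]
    simp
  | insert v s hv ih =>
    have hmeas : Measurable fun x : V → X => ∏ j, F j (fun a => x (φ j a)) :=
      Finset.measurable_fun_prod _ fun j _ => (hF j).comp (by fun_prop)
    rw [lmarginal_insert _ hmeas hv]
    obtain ⟨a, b, hab, hv2⟩ := hpair v
    set G : ∀ j, (ι j → X) → ℝ≥0∞ := fun j => ∫⋯∫⁻_(Finset.univ.filter fun a => φ j a ∈ s),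
      (fun y => F j y ^ 2) ∂(fun _ => volume) with hG
    have hGm : ∀ j, Measurable (G j) := fun j => ((hF j).pow_const 2).lmarginal _
    have hconst : ∀ j ∈ (Finset.univ.erase a).erase b, ∀ y,
        G j (fun c => Function.update x v y (φ j c)) =
          (∫⋯∫⁻_(Finset.univ.filter fun a => φ j a ∈ insert v s), (fun y => F j y ^ 2)
            ∂(fun _ => volume)) (fun a => x (φ j a)) := by
      intro j hj y
      have hne : ∀ c, φ j c ≠ v := fun c hc => by
        have := (hv2 j).1 ⟨c, hc⟩
        simp at hj
        tauto
      simp [hG, Finset.mem_insert, hne]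
    -- Injectivity of `φ j` means that updating `v` moves just one coordinate of the factor, so
    -- integrating over `v` adds one coordinate to its marginal.
    have hins : ∀ j, j = a ∨ j = b →
        ∫⁻ y, G j (fun c => Function.update x v y (φ j c)) =
          (∫⋯∫⁻_(Finset.univ.filter fun a => φ j a ∈ insert v s), (fun y => F j y ^ 2)
            ∂(fun _ => volume)) (fun a => x (φ j a)) := by
      intro j hj
      obtain ⟨c, hc⟩ := (hv2 j).2 hj
      have h1 : (Finset.univ.filter fun a => φ j a ∈ insert v s) =
          insert c (Finset.univ.filter fun a => φ j a ∈ s) := by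
        ext d
        simp only [Finset.mem_filter, Finset.mem_univ, true_and, Finset.mem_insert, ← hc,
          (hφ j).eq_iff]
      rw [h1, lmarginal_insert _ ((hF j).pow_const 2) (by simpa [hc] using hv)]
      refine lintegral_congr fun y => ?_
      congr 1
      ext d
      simp only [Function.update_apply, ← hc, (hφ j).eq_iff]
    calc ∫⁻ y, (∫⋯∫⁻_s, (fun x => ∏ j, F j (fun a => x (φ j a))) ∂(fun _ => volume))
            (Function.update x v y)
        ≤ ∫⁻ y, ∏ j, G j (fun c => Function.update x v y (φ j c)) ^ (1 / 2 : ℝ) :=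
          lintegral_mono fun y => ih _
      _ = ∫⁻ y, (G a (fun c => Function.update x v y (φ a c)) ^ (1 / 2 : ℝ) *
            G b (fun c => Function.update x v y (φ b c)) ^ (1 / 2 : ℝ)) *
            ∏ j ∈ (Finset.univ.erase a).erase b,
              ((∫⋯∫⁻_(Finset.univ.filter fun a => φ j a ∈ insert v s), (fun y => F j y ^ 2)
            ∂(fun _ => volume)) (fun a => x (φ j a))) ^ (1 / 2 : ℝ) := by
          refine lintegral_congr fun y => ?_
          rw [prod_eq_mul_mul_prod_erase _ hab]
          congr 1
          exact Finset.prod_congr rfl fun j hj => by rw [hconst j hj y]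
      _ = (∫⁻ y, (G a (fun c => Function.update x v y (φ a c)) ^ (1 / 2 : ℝ) *
            G b (fun c => Function.update x v y (φ b c)) ^ (1 / 2 : ℝ))) *
            ∏ j ∈ (Finset.univ.erase a).erase b,
              ((∫⋯∫⁻_(Finset.univ.filter fun a => φ j a ∈ insert v s), (fun y => F j y ^ 2)
            ∂(fun _ => volume)) (fun a => x (φ j a))) ^ (1 / 2 : ℝ) := by
          refine lintegral_mul_const _ (Measurable.mul ?_ ?_) <;>
            exact Measurable.pow_const ((hGm _).comp
              (measurable_pi_lambda _ fun c => (measurable_pi_apply _).comp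
                (measurable_update x))) _
      _ ≤ _ := by
          rw [prod_eq_mul_mul_prod_erase _ hab, ← hins a (Or.inl rfl), ← hins b (Or.inr rfl)]
          gcongr
          refine ENNReal.lintegral_mul_norm_pow_le ?_ ?_ (by norm_num) (by norm_num)
            (by norm_num) <;>
            exact ((hGm _).comp
              (measurable_pi_lambda _ fun c => (measurable_pi_apply _).comp
                (measurable_update x))).aemeasurable

/-- If every variable is shared by exactly two factors, the integral of a product is at most the
product of the `L²` norms of the factors. -/
theorem lintegral_prod_le_of_paired [Fintype V] [Nonempty X] {φ : ∀ j, ι j → V}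
    (hφ : ∀ j, Function.Injective (φ j))
    (hpair : ∀ v, ∃ a b, a ≠ b ∧ ∀ j, v ∈ Set.range (φ j) ↔ j = a ∨ j = b)
    {F : ∀ j, (ι j → X) → ℝ≥0∞} (hF : ∀ j, AEMeasurable (F j)) :
    ∫⁻ x : V → X, ∏ j, F j (fun a => x (φ j a)) ≤
      ∏ j, (∫⁻ y, F j y ^ 2) ^ (1 / 2 : ℝ) := by
  classical
  -- The marginal calculus needs measurable functions; null sets pull back to null sets under
  -- restriction of coordinates, so measurable representatives may be used.
  have h1 : ∫⁻ x : V → X, ∏ j, F j (fun a => x (φ j a)) =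
      ∫⁻ x : V → X, ∏ j, (hF j).mk (F j) (fun a => x (φ j a)) := by
    refine lintegral_congr_ae ?_
    have : ∀ j, ∀ᵐ x : V → X, F j (fun a => x (φ j a)) = (hF j).mk (F j) (fun a => x (φ j a)) :=
      fun j => (quasiMeasurePreserving_comp_injective (hφ j)).ae (hF j).ae_eq_mk
    filter_upwards [eventually_countable_forall.2 this] with x hx
    exact Finset.prod_congr rfl fun j _ => hx j
  have h2 : ∀ j, ∫⁻ y, F j y ^ 2 = ∫⁻ y, (hF j).mk (F j) y ^ 2 := fun j =>
    lintegral_congr_ae ((hF j).ae_eq_mk.mono fun y hy => by simp only [hy])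
  rw [h1]
  simp_rw [h2]
  -- Once all variables are integrated the base point is irrelevant, so any point will do.
  have := lmarginal_prod_le hφ hpair (fun j => (hF j).measurable_mk) Finset.univ
    (fun _ => Classical.arbitrary X)
  simpa [volume_pi] using this

end PairedProducts

/-! ### Composition of Hilbert–Schmidt kernels and the Gram kernel. -/

section Kernels

open scoped ComplexConjugate

variable {U S W : Type*} [MeasurableSpace U] [MeasurableSpace S] [MeasurableSpace W]
  {μ : Measure U} {ν : Measure S} {ρ : Measure W} [SFinite μ] [SFinite ν] [SFinite ρ]

theorem sq_eLpNorm_two {α E : Type*} [MeasurableSpace α] [NormedAddCommGroup E] (μ : Measure α)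
    (f : α → E) : eLpNorm f 2 μ ^ 2 = ∫⁻ x, ‖f x‖ₑ ^ 2 ∂μ := by
  have := eLpNorm_nnreal_pow_eq_lintegral (f := f) (μ := μ) (p := 2) (by norm_num)
  simp only [NNReal.coe_ofNat, ENNReal.coe_ofNat] at this
  exact_mod_cast this

theorem lintegral_mul_sq_le {α : Type*} [MeasurableSpace α] {μ : Measure α} {f g : α → ℝ≥0∞}
    (hf : AEMeasurable f μ) (hg : AEMeasurable g μ) :
    (∫⁻ x, f x * g x ∂μ) ^ 2 ≤ (∫⁻ x, f x ^ 2 ∂μ) * ∫⁻ x, g x ^ 2 ∂μ := by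
  have h := ENNReal.lintegral_mul_le_Lp_mul_Lq μ Real.HolderConjugate.two_two hf hg
  calc (∫⁻ x, f x * g x ∂μ) ^ 2
      ≤ ((∫⁻ x, f x ^ (2 : ℝ) ∂μ) ^ (1 / 2 : ℝ) * (∫⁻ x, g x ^ (2 : ℝ) ∂μ) ^ (1 / 2 : ℝ)) ^ 2 := by
        gcongr; exact h
    _ = _ := by
        have h2 : ∀ x : ℝ≥0∞, (x ^ (1 / 2 : ℝ)) ^ 2 = x := fun x => by
          rw [← ENNReal.rpow_natCast, ← ENNReal.rpow_mul]
          norm_num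
        rw [mul_pow, h2, h2]
        simp only [ENNReal.rpow_two]

/-- The kernel of the operator `A * A.adjoint`, where `A` maps functions on `U` to functions
on `S`. -/
noncomputable def gramKernel (μ : Measure U) (A : U × S → ℂ) (z : S × S) : ℂ :=
  ∫ u, A (u, z.1) * conj (A (u, z.2)) ∂μ

/-- Expanding the square and applying Fubini turns the left side into the integral of the Gram
kernel against `g ⊗ conj g`; Cauchy–Schwarz on `S × S` finishes, since `g ⊗ conj g` has norm `‖g‖²`.
-/
theorem lintegral_integral_mul_sq_le {A : U × S → ℂ} (hA : MemLp A 2 (μ.prod ν)) {g : S → ℂ}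
    (hg : MemLp g 2 ν) :
    ∫⁻ u, ‖∫ s, A (u, s) * g s ∂ν‖ₑ ^ 2 ∂μ ≤
      eLpNorm (gramKernel μ A) 2 (ν.prod ν) * eLpNorm g 2 ν ^ 2 := by
  set h : U → ℂ := fun u => ∫ s, A (u, s) * g s ∂ν with hh
  set Φ : U × (S × S) → ℂ := fun z =>
    (A (z.1, z.2.1) * g z.2.1) * conj (A (z.1, z.2.2) * g z.2.2) with hΦ
  have hAg : AEStronglyMeasurable (fun z : U × S => A z * g z.2) (μ.prod ν) :=
    hA.1.mul (hg.1.comp_quasiMeasurePreserving Measure.quasiMeasurePreserving_snd)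
  have hq1 : Measure.QuasiMeasurePreserving (fun z : U × (S × S) => (z.1, z.2.1))
      (μ.prod (ν.prod ν)) (μ.prod ν) :=
    QuasiMeasurePreserving.prodMap (.id μ) Measure.quasiMeasurePreserving_fst
  have hq2 : Measure.QuasiMeasurePreserving (fun z : U × (S × S) => (z.1, z.2.2))
      (μ.prod (ν.prod ν)) (μ.prod ν) :=
    QuasiMeasurePreserving.prodMap (.id μ) Measure.quasiMeasurePreserving_snd
  have hΦm : AEStronglyMeasurable Φ (μ.prod (ν.prod ν)) :=
    (hAg.comp_quasiMeasurePreserving hq1).mul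
      (Complex.continuous_conj.comp_aestronglyMeasurable (hAg.comp_quasiMeasurePreserving hq2))
  have hslice : ∀ᵐ u ∂μ, AEStronglyMeasurable (fun s => A (u, s)) ν := hA.1.prodMk_left
  -- Cauchy–Schwarz in `s` for almost every fixed `u` gives the bound `‖A‖² ‖g‖²`, which justifies
  -- Fubini.
  have hΦi : Integrable Φ (μ.prod (ν.prod ν)) := by
    refine ⟨hΦm, ?_⟩
    rw [hasFiniteIntegral_iff_enorm, lintegral_prod _ hΦm.enorm]
    calc ∫⁻ u, ∫⁻ z, ‖Φ (u, z)‖ₑ ∂(ν.prod ν) ∂μ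
        ≤ ∫⁻ u, (∫⁻ s, ‖A (u, s)‖ₑ ^ 2 ∂ν) * (∫⁻ s, ‖g s‖ₑ ^ 2 ∂ν) ∂μ := by
          refine lintegral_mono_ae ?_
          filter_upwards [hslice] with u hu
          have h1 : ∫⁻ z, ‖Φ (u, z)‖ₑ ∂(ν.prod ν) = (∫⁻ s, ‖A (u, s)‖ₑ * ‖g s‖ₑ ∂ν) ^ 2 := by
            have hm : AEMeasurable (fun s => ‖A (u, s)‖ₑ * ‖g s‖ₑ) ν := hu.enorm.mul hg.1.enorm
            rw [sq, ← lintegral_prod_mul hm hm]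
            simp [hΦ, enorm_mul]
          rw [h1]
          exact lintegral_mul_sq_le hu.enorm hg.1.enorm
      _ = eLpNorm A 2 (μ.prod ν) ^ 2 * eLpNorm g 2 ν ^ 2 := by
          rw [lintegral_mul_const'' _ (hA.1.enorm.pow_const 2).lintegral_prod_right',
            sq_eLpNorm_two, sq_eLpNorm_two, lintegral_prod _ (hA.1.enorm.pow_const 2)]
      _ < ∞ := ENNReal.mul_lt_top (ENNReal.pow_lt_top hA.2) (ENNReal.pow_lt_top hg.2)
  have hinner : ∀ u, ∫ z, Φ (u, z) ∂(ν.prod ν) = ((‖h u‖ ^ 2 : ℝ) : ℂ) := by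
    intro u
    simp only [hΦ]
    rw [integral_prod_mul (fun s => A (u, s) * g s) (fun s => conj (A (u, s) * g s)),
      integral_conj, Complex.mul_conj, Complex.normSq_eq_norm_sq]
  have hhi : Integrable (fun u => ((‖h u‖ ^ 2 : ℝ) : ℂ)) μ :=
    hΦi.integral_prod_left.congr (.of_forall hinner)
  have hhr : Integrable (fun u => ‖h u‖ ^ 2) μ := by
    simpa only [RCLike.re_eq_complex_re, Complex.ofReal_re] using hhi.re
  have hfub : ((∫ u, ‖h u‖ ^ 2 ∂μ : ℝ) : ℂ) =
      ∫ z, gramKernel μ A z * (g z.1 * conj (g z.2)) ∂(ν.prod ν) := by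
    rw [← integral_complex_ofReal]
    simp_rw [← hinner]
    rw [integral_integral_swap hΦi]
    refine integral_congr_ae (.of_forall fun z => ?_)
    simp only [hΦ, gramKernel]
    rw [← integral_mul_const]
    congr 1 with u
    simp only [map_mul]
    ring
  have hgg : AEStronglyMeasurable (fun z : S × S => g z.1 * conj (g z.2)) (ν.prod ν) :=
    (hg.1.comp_quasiMeasurePreserving Measure.quasiMeasurePreserving_fst).mul
      (Complex.continuous_conj.comp_aestronglyMeasurable
        (hg.1.comp_quasiMeasurePreserving Measure.quasiMeasurePreserving_snd))
  have hLm : AEStronglyMeasurable (gramKernel μ A) (ν.prod ν) := by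
    have : AEStronglyMeasurable (fun z : U × (S × S) => A (z.1, z.2.1) * conj (A (z.1, z.2.2)))
        (μ.prod (ν.prod ν)) :=
      (hA.1.comp_quasiMeasurePreserving hq1).mul
        (Complex.continuous_conj.comp_aestronglyMeasurable (hA.1.comp_quasiMeasurePreserving hq2))
    exact this.prod_swap.integral_prod_right'
  calc ∫⁻ u, ‖h u‖ₑ ^ 2 ∂μ = ∫⁻ u, ENNReal.ofReal (‖h u‖ ^ 2) ∂μ := by
        refine lintegral_congr fun u => ?_
        rw [ENNReal.ofReal_pow (norm_nonneg _), ofReal_norm]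
    _ = ENNReal.ofReal (∫ u, ‖h u‖ ^ 2 ∂μ) :=
        (ofReal_integral_eq_lintegral_ofReal hhr (.of_forall fun u => by positivity)).symm
    _ = ‖((∫ u, ‖h u‖ ^ 2 ∂μ : ℝ) : ℂ)‖ₑ := by
        rw [← ofReal_norm, Complex.norm_real, Real.norm_of_nonneg]
        exact integral_nonneg fun u => by positivity
    _ ≤ ∫⁻ z, ‖gramKernel μ A z‖ₑ * ‖g z.1 * conj (g z.2)‖ₑ ∂(ν.prod ν) := by
        rw [hfub]
        refine (enorm_integral_le_lintegral_enorm _).trans_eq (lintegral_congr fun z => ?_)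
        rw [enorm_mul]
    _ ≤ _ := by
        rw [← ENNReal.pow_le_pow_left_iff (two_ne_zero), mul_pow, sq_eLpNorm_two]
        refine (lintegral_mul_sq_le hLm.enorm hgg.enorm).trans_eq ?_
        congr 1
        rw [sq_eLpNorm_two, sq, ← lintegral_prod_mul (hg.1.enorm.pow_const 2)
          (hg.1.enorm.pow_const 2)]
        simp [mul_pow]

theorem aestronglyMeasurable_integral_mul {A : U × S → ℂ} {B : S × W → ℂ}
    (hA : AEStronglyMeasurable A (μ.prod ν)) (hB : AEStronglyMeasurable B (ν.prod ρ)) :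
    AEStronglyMeasurable (fun z : U × W => ∫ s, A (z.1, s) * B (s, z.2) ∂ν) (μ.prod ρ) := by
  have hq1 : Measure.QuasiMeasurePreserving (fun z : (U × W) × S => (z.1.1, z.2))
      ((μ.prod ρ).prod ν) (μ.prod ν) := 
    QuasiMeasurePreserving.prodMap Measure.quasiMeasurePreserving_fst (.id ν)
  have hq2 : Measure.QuasiMeasurePreserving (fun z : (U × W) × S => (z.2, z.1.2))
      ((μ.prod ρ).prod ν) (ν.prod ρ) := 
    Measure.measurePreserving_swap.quasiMeasurePreserving.comp
      (QuasiMeasurePreserving.prodMap Measure.quasiMeasurePreserving_snd (.id ν))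
  exact ((hA.comp_quasiMeasurePreserving hq1).mul
    (hB.comp_quasiMeasurePreserving hq2)).integral_prod_right'

/-- The estimate for a single function `g` is applied to almost every slice `B (·, w)` and
integrated over `w`. -/
theorem eLpNorm_integral_mul_le {A : U × S → ℂ} {B : S × W → ℂ}
    (hA : MemLp A 2 (μ.prod ν)) (hB : MemLp B 2 (ν.prod ρ)) :
    eLpNorm (fun z : U × W => ∫ s, A (z.1, s) * B (s, z.2) ∂ν) 2 (μ.prod ρ) ^ 2 ≤
      eLpNorm (gramKernel μ A) 2 (ν.prod ν) * eLpNorm B 2 (ν.prod ρ) ^ 2 := by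
  have hm := aestronglyMeasurable_integral_mul hA.1 hB.1
  have hBm : AEMeasurable (fun z => ‖B z‖ₑ ^ 2) (ν.prod ρ) := hB.1.enorm.pow_const 2
  rw [sq_eLpNorm_two, lintegral_prod_symm _ (hm.enorm.pow_const 2)]
  have hslice : ∀ᵐ w ∂ρ, MemLp (fun s => B (s, w)) 2 ν := by
    have h1 : ∀ᵐ w ∂ρ, AEStronglyMeasurable (fun s => B (s, w)) ν := hB.1.prod_swap.prodMk_left
    have h2 : ∀ᵐ w ∂ρ, ∫⁻ s, ‖B (s, w)‖ₑ ^ 2 ∂ν < ∞ := by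
      refine ae_lt_top' hBm.prod_swap.lintegral_prod_right' ?_
      rw [← lintegral_prod_symm _ hBm, ← sq_eLpNorm_two]
      exact (ENNReal.pow_lt_top hB.2).ne
    filter_upwards [h1, h2] with w hw1 hw2
    refine ⟨hw1, ?_⟩
    rw [← sq_eLpNorm_two] at hw2
    exact (ENNReal.pow_lt_top_iff.1 hw2).resolve_right two_ne_zero
  calc ∫⁻ w, ∫⁻ u, ‖∫ s, A (u, s) * B (s, w) ∂ν‖ₑ ^ 2 ∂μ ∂ρ
      ≤ ∫⁻ w, eLpNorm (gramKernel μ A) 2 (ν.prod ν) * ∫⁻ s, ‖B (s, w)‖ₑ ^ 2 ∂ν ∂ρ := by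
        refine lintegral_mono_ae ?_
        filter_upwards [hslice] with w hw
        rw [← sq_eLpNorm_two ν]
        exact lintegral_integral_mul_sq_le hA hw
    _ = _ := by
        rw [lintegral_const_mul'' _ (f := fun w => ∫⁻ s, ‖B (s, w)‖ₑ ^ 2 ∂ν)
          hBm.prod_swap.lintegral_prod_right',
          ← lintegral_prod_symm _ hBm, sq_eLpNorm_two ]

/-- Transposing the composition exchanges the roles of the two kernels. -/
theorem eLpNorm_integral_mul_le' {A : U × S → ℂ} {B : S × W → ℂ}
    (hA : MemLp A 2 (μ.prod ν)) (hB : MemLp B 2 (ν.prod ρ)) :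
    eLpNorm (fun z : U × W => ∫ s, A (z.1, s) * B (s, z.2) ∂ν) 2 (μ.prod ρ) ^ 2 ≤
      eLpNorm (gramKernel ρ fun z => B z.swap) 2 (ν.prod ν) * eLpNorm A 2 (μ.prod ν) ^ 2 := by
  have h := eLpNorm_integral_mul_le (hB.comp_measurePreserving Measure.measurePreserving_swap)
    (hA.comp_measurePreserving Measure.measurePreserving_swap)
  rw [eLpNorm_comp_measurePreserving hA.1 Measure.measurePreserving_swap,
    ← eLpNorm_comp_measurePreserving (f := Prod.swap) (μ := μ.prod ρ) ?_ Measure.measurePreserving_swap] at h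
  · refine le_trans (le_of_eq ?_) h
    congr 3 with z
    simp [mul_comm]
  · have := (aestronglyMeasurable_integral_mul hA.1 hB.1).prod_swap
    refine this.congr (.of_forall fun z => ?_)
    simp [mul_comm]

end Kernels

/-! ### Contractions as compositions of kernels, and mirror symmetry. -/

section Contractions

open scoped ComplexConjugate

variable {X : Type*} [MeasureSpace X]

/-- The first `a` and the last `b` of `n` coordinates. -/
def finSplit {a b n : ℕ} (h : a + b = n) : Fin a ⊕ Fin b ≃ Fin n :=
  finSumFinEquiv.trans (finCongr h)

/-- A function of `n = a + b` variables as a function of its first `a` and its last `b`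
variables. -/
def splitKernel {a b n : ℕ} (h : a + b = n) (f : (Fin n → X) → ℂ)
    (z : (Fin a → X) × (Fin b → X)) : ℂ :=
  f ((piSplit X (finSplit h)).symm z)

theorem piSplit_finSplit_symm {a b n : ℕ} (h : a + b = n) (z : (Fin a → X) × (Fin b → X)) :
    (piSplit X (finSplit h)).symm z = Fin.append z.1 z.2 ∘ Fin.cast h.symm := by
  subst h
  funext i
  refine Fin.addCases (fun j => ?_) (fun j => ?_) i
  · exact (piSplit_symm_inl (finSplit rfl) z j).trans (Fin.append_left _ _ j).symm
  · exact (piSplit_symm_inr (finSplit rfl) z j).trans (Fin.append_right _ _ j).symm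

/-- The contraction of the last `p` variables of `f` with the first `p` variables of `g`, as a
function of the remaining variables of `f` and of the remaining variables of `g`. -/
noncomputable def contractionKernel {a b p n m : ℕ} (h₁ : a + p = n) (h₂ : p + b = m)
    (f : (Fin n → X) → ℂ) (g : (Fin m → X) → ℂ) (z : (Fin a → X) × (Fin b → X)) : ℂ :=
  ∫ s : Fin p → X, splitKernel h₁ f (z.1, s) * splitKernel h₂ g (fun a => s a.rev, z.2)

variable [SigmaFinite (volume : Measure X)]

theorem measurePreserving_comp_rev (p : ℕ) :
    MeasurePreserving (fun (s : Fin p → X) (a : Fin p) => s a.rev) volume volume := by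
  convert volume_measurePreserving_piCongrLeft (fun _ => X) (Fin.revPerm (n := p)) using 1
  funext s a
  obtain ⟨b, rfl⟩ := Fin.revPerm.surjective a
  rw [MeasurableEquiv.piCongrLeft_apply_apply]
  simp

theorem integral_comp_rev {p : ℕ} (F : (Fin p → X) → ℂ) :
    ∫ s : Fin p → X, F (fun a => s a.rev) = ∫ s, F s := by
  have h := (measurePreserving_comp_rev (X := X) p)
  refine h.integral_comp ?_ F
  have : (fun (s : Fin p → X) (a : Fin p) => s a.rev) =
      MeasurableEquiv.piCongrLeft (fun _ => X) (Fin.revPerm (n := p)) := by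
    funext s a
    obtain ⟨b, rfl⟩ := Fin.revPerm.surjective a
    rw [MeasurableEquiv.piCongrLeft_apply_apply]
    simp
  rw [this]
  exact MeasurableEquiv.measurableEmbedding _

theorem MeasureTheory.MemLp.splitKernel {a b n : ℕ} (h : a + b = n) {f : (Fin n → X) → ℂ}
    (hf : MemLp f 2) : MemLp (splitKernel h f) 2 :=
  hf.comp_measurePreserving (measurePreserving_piSplit _).symm

theorem eLpNorm_splitKernel {a b n : ℕ} (h : a + b = n) {f : (Fin n → X) → ℂ}
    (hf : MemLp f 2) : eLpNorm (splitKernel h f) 2 volume = eLpNorm f 2 volume :=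
  eLpNorm_comp_measurePreserving hf.1 (measurePreserving_piSplit _).symm

theorem measurePreserving_rev_fst (a b : ℕ) :
    MeasurePreserving (fun z : (Fin a → X) × (Fin b → X) =>
      ((fun i => z.1 i.rev, z.2) : (Fin a → X) × (Fin b → X)))
      volume volume :=
  (measurePreserving_comp_rev a).prod (.id _)

theorem measurePreserving_rev_snd (a b : ℕ) :
    MeasurePreserving (fun z : (Fin a → X) × (Fin b → X) =>
      ((z.1, fun i => z.2 i.rev) : (Fin a → X) × (Fin b → X)))
      volume volume :=
  (MeasurePreserving.id _).prod (measurePreserving_comp_rev b)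

theorem aestronglyMeasurable_contractionKernel {a b p n m : ℕ} (h₁ : a + p = n) (h₂ : p + b = m)
    {f : (Fin n → X) → ℂ} {g : (Fin m → X) → ℂ} (hf : MemLp f 2) (hg : MemLp g 2) :
    AEStronglyMeasurable (contractionKernel h₁ h₂ f g) volume :=
  aestronglyMeasurable_integral_mul (hf.splitKernel h₁).1
    ((hg.splitKernel h₂).comp_measurePreserving (measurePreserving_rev_fst p b)).1

theorem aestronglyMeasurable_gramKernel {U S : Type*} [MeasurableSpace U] [MeasurableSpace S]
    {μ : Measure U} {ν : Measure S} [SFinite μ] [SFinite ν] {A : U × S → ℂ}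
    (hA : AEStronglyMeasurable A (μ.prod ν)) :
    AEStronglyMeasurable (gramKernel μ A) (ν.prod ν) :=
  aestronglyMeasurable_integral_mul (A := fun z : S × U => A z.swap)
    (B := fun z : U × S => conj (A z)) hA.prod_swap
    (Complex.continuous_conj.comp_aestronglyMeasurable hA)

theorem splitKernel_ae_eq_conj {a b n : ℕ} (h : a + b = n) (h' : b + a = n)
    {f : (Fin n → X) → ℂ} (hm : ∀ᵐ t : Fin n → X, f t = conj (f fun j => t j.rev)) :
    ∀ᵐ z : (Fin a → X) × (Fin b → X),
      splitKernel h f z = conj (splitKernel h' f (fun i => z.2 i.rev, fun i => z.1 i.rev)) := by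
  filter_upwards [(measurePreserving_piSplit (finSplit h)).symm.quasiMeasurePreserving.ae hm]
    with z hz
  rw [splitKernel, hz, splitKernel]
  congr 2
  simp only [piSplit_finSplit_symm]
  funext j
  -- Reversal carries the first `b` positions to the last `b`, and the remaining `a` to the first
  -- `a`.
  by_cases hj : (j : ℕ) < b
  · have e1 : Fin.cast h.symm j.rev = Fin.natAdd a (Fin.rev ⟨j, hj⟩) := by
      ext; simp [Fin.val_rev]; omega
    have e2 : Fin.cast h'.symm j = Fin.castAdd a ⟨j, hj⟩ := by ext; simp
    simp only [Function.comp_apply, e1, e2, Fin.append_left, Fin.append_right]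
  · have e1 : Fin.cast h.symm j.rev = Fin.castAdd b (Fin.rev ⟨j - b, by omega⟩) := by
      ext; simp [Fin.val_rev]; omega
    have e2 : Fin.cast h'.symm j = Fin.natAdd b ⟨j - b, by omega⟩ := by ext; simp; omega
    simp only [Function.comp_apply, e1, e2, Fin.append_left, Fin.append_right]

/-- Mirror symmetry rewrites `conj f(u, s')` as `f(rev s', rev u)`, so integrating over the first
`a` variables is a contraction of order `a`, up to a measure-preserving change of the free
variables. -/
theorem eLpNorm_gramKernel_splitKernel {a p n : ℕ} (h : a + p = n) (h' : p + a = n)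
    {f : (Fin n → X) → ℂ} (hf : MemLp f 2)
    (hm : ∀ᵐ t : Fin n → X, f t = conj (f fun j => t j.rev)) :
    eLpNorm (gramKernel volume (splitKernel h f)) 2 volume =
      eLpNorm (contractionKernel h' h f f) 2 volume := by
  have hmp : MeasurePreserving (fun z : (Fin p → X) × (Fin p → X) =>
      ((z.2, fun i => z.1 i.rev) : (Fin p → X) × (Fin p → X)))
      volume volume :=
    (measurePreserving_rev_snd p p).comp Measure.measurePreserving_swap
  have hgm : AEStronglyMeasurable (gramKernel volume (splitKernel h f)) volume :=
    aestronglyMeasurable_gramKernel (hf.splitKernel h).1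
  rw [← eLpNorm_comp_measurePreserving hgm hmp]
  refine eLpNorm_congr_ae ?_
  have h1 : ∀ᵐ t : Fin p → X, ∀ᵐ v : Fin a → X,
      splitKernel h' f (t, v) = conj (splitKernel h f (fun i => v i.rev, fun i => t i.rev)) :=
    Measure.ae_ae_of_ae_prod (splitKernel_ae_eq_conj h' h hm)
  have h2 := Measure.quasiMeasurePreserving_fst
    (μ := (volume : Measure (Fin p → X))) (ν := (volume : Measure (Fin p → X))) |>.ae h1
  filter_upwards [h2] with z hz
  rw [Function.comp_apply, gramKernel, contractionKernel, ← integral_comp_rev]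
  refine integral_congr_ae ?_
  filter_upwards [hz] with v hv
  rw [hv, mul_comm]

/-- The counterpart for the right-hand factor: here the last `b` variables are integrated, and `conj
g(rev t, v) = g(rev v, t)`. -/
theorem eLpNorm_gramKernel_swap_splitKernel {b p m : ℕ} (h : p + b = m) (h' : b + p = m)
    {g : (Fin m → X) → ℂ} (hg : MemLp g 2)
    (hm : ∀ᵐ t : Fin m → X, g t = conj (g fun j => t j.rev)) :
    eLpNorm (gramKernel volume fun z : (Fin b → X) × (Fin p → X) =>
        splitKernel h g (fun i => z.2 i.rev, z.1)) 2 volume =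
      eLpNorm (contractionKernel h h' g g) 2 volume := by
  have hB : MemLp (fun z : (Fin b → X) × (Fin p → X) =>
      splitKernel h g (fun i => z.2 i.rev, z.1)) 2 :=
    (hg.splitKernel h).comp_measurePreserving
      ((measurePreserving_rev_fst p b).comp Measure.measurePreserving_swap)
  have hgm : AEStronglyMeasurable (gramKernel volume fun z : (Fin b → X) × (Fin p → X) =>
      splitKernel h g (fun i => z.2 i.rev, z.1)) volume :=
    aestronglyMeasurable_gramKernel hB.1
  rw [← eLpNorm_comp_measurePreserving hgm (measurePreserving_rev_fst p p)]
  refine eLpNorm_congr_ae ?_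
  have h1 : ∀ᵐ t : Fin p → X, ∀ᵐ v : Fin b → X,
      splitKernel h' g (fun i => v i.rev, t) = conj (splitKernel h g (fun i => t i.rev, v)) := by
    refine Measure.ae_ae_of_ae_prod (?_ : ∀ᵐ z : (Fin p → X) × (Fin b → X),
      splitKernel h' g (fun i => z.2 i.rev, z.1) =
        conj (splitKernel h g (fun i => z.1 i.rev, z.2)))
    filter_upwards [((measurePreserving_rev_fst b p).comp
      Measure.measurePreserving_swap).quasiMeasurePreserving.ae (splitKernel_ae_eq_conj h' h hm)]
      with z hz
    simpa using hz
  have h2 := Measure.quasiMeasurePreserving_snd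
    (μ := (volume : Measure (Fin p → X))) (ν := (volume : Measure (Fin p → X))) |>.ae h1
  filter_upwards [h2] with z hz
  rw [Function.comp_apply, gramKernel, contractionKernel]
  refine integral_congr_ae ?_
  filter_upwards [hz] with v hv
  rw [hv]
  simp

/-- The order `p` contraction of `f` with any `g` is controlled by the contraction of `f` with
itself of order `a = n - p`, which lies in the range `1, …, n - 1` as soon as `a, p ≥ 1`. -/
theorem eLpNorm_contractionKernel_sq_le_left {a b p n m : ℕ} (h₁ : a + p = n) (h₁' : p + a = n)
    (h₂ : p + b = m) {f : (Fin n → X) → ℂ} {g : (Fin m → X) → ℂ} (hf : MemLp f 2)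
    (hg : MemLp g 2) (hm : ∀ᵐ t : Fin n → X, f t = conj (f fun j => t j.rev)) :
    eLpNorm (contractionKernel h₁ h₂ f g) 2 volume ^ 2 ≤
      eLpNorm (contractionKernel h₁' h₁ f f) 2 volume * eLpNorm g 2 volume ^ 2 := by
  have hA : MemLp (splitKernel h₁ f) 2 (volume.prod volume) := hf.splitKernel h₁
  have hB : MemLp (splitKernel h₂ g ∘ fun z : (Fin p → X) × (Fin b → X) =>
      ((fun i => z.1 i.rev, z.2) : (Fin p → X) × (Fin b → X))) 2 (volume.prod volume) :=
    (hg.splitKernel h₂).comp_measurePreserving (measurePreserving_rev_fst p b)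
  have hBn := (eLpNorm_comp_measurePreserving (hg.splitKernel h₂).1
    (measurePreserving_rev_fst p b)).trans (eLpNorm_splitKernel h₂ hg)
  have h := eLpNorm_integral_mul_le hA hB
  rw [← Measure.volume_eq_prod, ← Measure.volume_eq_prod, ← Measure.volume_eq_prod, hBn] at h
  rw [← eLpNorm_gramKernel_splitKernel h₁ h₁' hf hm]
  have e : contractionKernel h₁ h₂ f g = (fun z => ∫ s, splitKernel h₁ f (z.1, s) *
      (splitKernel h₂ g ∘ fun z : (Fin p → X) × (Fin b → X) =>
      ((fun i => z.1 i.rev, z.2) : (Fin p → X) × (Fin b → X))) (s, z.2)) := rfl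
  rw [e]
  exact h

theorem eLpNorm_contractionKernel_sq_le_right {a b p n m : ℕ} (h₁ : a + p = n)
    (h₂ : p + b = m) (h₂' : b + p = m) {f : (Fin n → X) → ℂ} {g : (Fin m → X) → ℂ}
    (hf : MemLp f 2) (hg : MemLp g 2)
    (hm : ∀ᵐ t : Fin m → X, g t = conj (g fun j => t j.rev)) :
    eLpNorm (contractionKernel h₁ h₂ f g) 2 volume ^ 2 ≤
      eLpNorm (contractionKernel h₂ h₂' g g) 2 volume * eLpNorm f 2 volume ^ 2 := by
  have hA : MemLp (splitKernel h₁ f) 2 (volume.prod volume) := hf.splitKernel h₁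
  have hB : MemLp (splitKernel h₂ g ∘ fun z : (Fin p → X) × (Fin b → X) =>
      ((fun i => z.1 i.rev, z.2) : (Fin p → X) × (Fin b → X))) 2 (volume.prod volume) :=
    (hg.splitKernel h₂).comp_measurePreserving (measurePreserving_rev_fst p b)
  have h := eLpNorm_integral_mul_le' hA hB
  rw [← Measure.volume_eq_prod, ← Measure.volume_eq_prod, ← Measure.volume_eq_prod,
    eLpNorm_splitKernel h₁ hf] at h
  rw [← eLpNorm_gramKernel_swap_splitKernel h₂ h₂' hg hm]
  have e : contractionKernel h₁ h₂ f g = (fun z => ∫ s, splitKernel h₁ f (z.1, s) *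
      (splitKernel h₂ g ∘ fun z : (Fin p → X) × (Fin b → X) =>
      ((fun i => z.1 i.rev, z.2) : (Fin p → X) × (Fin b → X))) (s, z.2)) := rfl
  rw [e]
  exact h

namespace WignerChaos

theorem eLpNorm_contraction {a b p n m : ℕ} (h₁ : a + p = n) (h₂ : p + b = m) (hn : p ≤ n)
    (hm : p ≤ m) {f : (Fin n → ℝ≥0) → ℂ} {g : (Fin m → ℝ≥0) → ℂ} (hf : MemLp f 2)
    (hg : MemLp g 2) :
    eLpNorm (contraction p hn hm f g) 2 volume =
      eLpNorm (contractionKernel h₁ h₂ f g) 2 volume := by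
  obtain rfl : a = n - p := by omega
  obtain rfl : b = m - p := by omega
  rw [← eLpNorm_comp_measurePreserving (aestronglyMeasurable_contractionKernel h₁ h₂ hf hg)
    (measurePreserving_piSplit finSumFinEquiv)]
  congr 1
  funext t
  simp only [Function.comp_apply, contraction, contractionKernel, splitKernel,
    piSplit_finSplit_symm]
  rfl

end WignerChaos

end Contractions

/-! ### Integrals of paired products, and the contraction of two factors. -/

section PairedIntegrals

universe u

variable {X : Type*} [MeasureSpace X] [SigmaFinite (volume : Measure X)] [Nonempty X]

theorem rpow_lintegral_sq_eq_eLpNorm {α E : Type*} [MeasurableSpace α] [NormedAddCommGroup E]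
    (μ : Measure α) (f : α → E) :
    (∫⁻ x, ‖f x‖ₑ ^ 2 ∂μ) ^ (1 / 2 : ℝ) = eLpNorm f 2 μ := by
  rw [← sq_eLpNorm_two, ← ENNReal.rpow_natCast, ← ENNReal.rpow_mul]
  norm_num

/-- A version of `lintegral_prod_le_of_paired` in which one factor is singled out. -/
theorem lintegral_mul_prod_le_of_paired {J V : Type*} [Fintype J] [Fintype V] {κ : Type u}
    [Fintype κ] {ι : J → Type u} [∀ j, Fintype (ι j)] {ψ : κ → V} (hψ : Function.Injective ψ)
    {φ : ∀ j, ι j → V} (hφ : ∀ j, Function.Injective (φ j))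
    (hone : ∀ v ∈ Set.range ψ, ∃ a, ∀ j, v ∈ Set.range (φ j) ↔ j = a)
    (htwo : ∀ v ∉ Set.range ψ, ∃ a b, a ≠ b ∧ ∀ j, v ∈ Set.range (φ j) ↔ j = a ∨ j = b)
    {G : (κ → X) → ℝ≥0∞} (hG : AEMeasurable G) {F : ∀ j, (ι j → X) → ℝ≥0∞}
    (hF : ∀ j, AEMeasurable (F j)) :
    ∫⁻ x : V → X, G (fun c => x (ψ c)) * ∏ j, F j (fun a => x (φ j a)) ≤
      (∫⁻ y, G y ^ 2) ^ (1 / 2 : ℝ) * ∏ j, (∫⁻ y, F j y ^ 2) ^ (1 / 2 : ℝ) := by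
  -- The distinguished factor is indexed by `none`, which reduces the claim to the symmetric
  -- version.
  let ι' : Option J → Type u := fun o => match o with
    | none => κ
    | some j => ι j
  let φ' : ∀ o, ι' o → V := fun o => match o with
    | none => ψ
    | some j => φ j
  let F' : ∀ o, (ι' o → X) → ℝ≥0∞ := fun o => match o with
    | none => G
    | some j => F j
  let inst : ∀ o, Fintype (ι' o) := fun o => match o with
    | none => inferInstanceAs (Fintype κ)
    | some j => inferInstanceAs (Fintype (ι j))
  have h := lintegral_prod_le_of_paired (X := X) (φ := φ') (F := F') ?_ ?_ ?_
  · simpa only [Fintype.prod_option] using h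
  · rintro (_ | j)
    exacts [hψ, hφ j]
  · intro v
    by_cases hv : v ∈ Set.range ψ
    · obtain ⟨a, ha⟩ := hone v hv
      refine ⟨none, some a, by simp, ?_⟩
      rintro (_ | j)
      · simpa using hv
      · simpa using ha j
    · obtain ⟨a, b, hab, h⟩ := htwo v hv
      refine ⟨some a, some b, by simpa using hab, ?_⟩
      rintro (_ | j)
      · simpa using hv
      · simpa using h j
  · rintro (_ | j)
    exacts [hG, hF j]

variable {J V : Type*} [Fintype J] [Fintype V] {m : J → ℕ} {φ : ∀ j, Fin (m j) → V}
  {F : ∀ j, (Fin (m j) → X) → ℂ}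

theorem integrable_prod_of_paired (hφ : ∀ j, Function.Injective (φ j))
    (hpair : ∀ v, ∃ a b, a ≠ b ∧ ∀ j, v ∈ Set.range (φ j) ↔ j = a ∨ j = b)
    (hF : ∀ j, MemLp (F j) 2) :
    Integrable fun x : V → X => ∏ j, F j (fun a => x (φ j a)) := by
  refine ⟨Finset.aestronglyMeasurable_fun_prod _ fun j _ =>
    (hF j).1.comp_quasiMeasurePreserving (quasiMeasurePreserving_comp_injective (hφ j)), ?_⟩
  rw [hasFiniteIntegral_iff_enorm]
  calc ∫⁻ x : V → X, ‖∏ j, F j (fun a => x (φ j a))‖ₑ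
      = ∫⁻ x : V → X, ∏ j, ‖F j (fun a => x (φ j a))‖ₑ := by
        simp only [enorm_eq_nnnorm, nnnorm_prod, ENNReal.ofNNReal_finsetProd]
    _ ≤ ∏ j, (∫⁻ y, ‖F j y‖ₑ ^ 2) ^ (1 / 2 : ℝ) :=
        lintegral_prod_le_of_paired hφ hpair fun j => (hF j).1.enorm
    _ < ∞ := by
        simp only [rpow_lintegral_sq_eq_eLpNorm]
        exact ENNReal.prod_lt_top fun j _ => (hF j).2

/-- Contracting two factors along all the variables that they share. -/
theorem enorm_integral_prod_le [DecidableEq J] (hφ : ∀ j, Function.Injective (φ j))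
    (hpair : ∀ v, ∃ a b, a ≠ b ∧ ∀ j, v ∈ Set.range (φ j) ↔ j = a ∨ j = b)
    (hF : ∀ j, MemLp (F j) 2) {j j' : J} (hjj : j ≠ j') {a b p : ℕ} (h₁ : a + p = m j)
    (h₂ : p + b = m j')
    (hlink : ∀ c : Fin p, φ j (finSplit h₁ (.inr c)) = φ j' (finSplit h₂ (.inl c.rev)))
    (hmax : ∀ α β, φ j α = φ j' β → (β : ℕ) < p) :
    ‖∫ x : V → X, ∏ l, F l (fun a => x (φ l a))‖ₑ ≤
      eLpNorm (contractionKernel h₁ h₂ (F j) (F j')) 2 volume *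
        ∏ l ∈ (Finset.univ.erase j).erase j', eLpNorm (F l) 2 volume := by
  classical
  set P : Fin p → V := fun c => φ j (finSplit h₁ (.inr c)) with hP
  have hPinj : Function.Injective P := fun c d h => by simpa using hφ j h
  have hj : ∀ c, P c ∈ Set.range (φ j) := fun c => ⟨_, rfl⟩
  have hj' : ∀ c, P c ∈ Set.range (φ j') := fun c => ⟨_, (hlink c).symm⟩
  -- A contracted variable already has `j` and `j'` as its two factors, so no third factor contains
  -- it.
  have hnot : ∀ l, l ≠ j → l ≠ j' → ∀ a, φ l a ∉ Set.range P := by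
    rintro l hl hl' a ⟨c, hc⟩
    obtain ⟨a₀, b₀, -, h⟩ := hpair (P c)
    have h1 := (h j).1 (hj c)
    have h2 := (h j').1 (hj' c)
    have h3 := (h l).1 ⟨a, hc.symm⟩
    grind
  have hnotj : ∀ c, φ j (finSplit h₁ (.inl c)) ∉ Set.range P := by
    rintro c ⟨d, hd⟩
    simpa using hφ j hd
  have hnotj' : ∀ c, φ j' (finSplit h₂ (.inr c)) ∉ Set.range P := by
    rintro c ⟨d, hd⟩
    rw [hP] at hd
    simp only [hlink] at hd
    simpa using hφ j' hd
  let Q := {v // v ∉ Set.range P}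
  let e : Fin p ⊕ Q ≃ V :=
    ((Equiv.ofInjective P hPinj).sumCongr (Equiv.refl _)).trans (Equiv.sumCompl (· ∈ Set.range P))
  have heP : ∀ c, P c = e (.inl c) := fun c => rfl
  have heQ : ∀ v (hv : v ∉ Set.range P), v = e (.inr ⟨v, hv⟩) := fun v hv => rfl
  let ψ : Fin a ⊕ Fin b → Q := Sum.elim (fun c => ⟨_, hnotj c⟩) (fun c => ⟨_, hnotj' c⟩)
  let J' := {l // l ≠ j ∧ l ≠ j'}
  let φ' : ∀ l : J', Fin (m l.1) → Q := fun l a => ⟨_, hnot l.1 l.2.1 l.2.2 a⟩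
  -- By `hmax` all shared variables are contracted, so the variables of the contraction are distinct
  -- and each occurs in exactly one further factor.
  have hshared : ∀ v : Q, ¬ (v.1 ∈ Set.range (φ j) ∧ v.1 ∈ Set.range (φ j')) := by
    rintro v ⟨⟨α, hα⟩, ⟨β, hβ⟩⟩
    have hlt := hmax α β (hα.trans hβ.symm)
    refine v.2 ⟨Fin.rev ⟨β, hlt⟩, ?_⟩
    change φ j _ = v.1
    rw [hlink, Fin.rev_rev, ← hβ]
    congr 1
  have hψinj : Function.Injective ψ := by
    refine Function.Injective.sumElim (fun c d h => ?_) (fun c d h => ?_) (fun c d h => ?_)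
    · simpa using hφ j (Subtype.ext_iff.1 h)
    · simpa using hφ j' (Subtype.ext_iff.1 h)
    · exact hshared ⟨_, hnotj c⟩ ⟨⟨_, rfl⟩, ⟨_, (Subtype.ext_iff.1 h).symm⟩⟩
  have hψrange : ∀ v : Q, v ∈ Set.range ψ ↔ v.1 ∈ Set.range (φ j) ∨ v.1 ∈ Set.range (φ j') := by
    intro v
    constructor
    · rintro ⟨c | c, rfl⟩
      · exact Or.inl ⟨_, rfl⟩
      · exact Or.inr ⟨_, rfl⟩
    · rintro (⟨α, hα⟩ | ⟨α, hα⟩)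
      · obtain ⟨c | c, rfl⟩ := (finSplit h₁).surjective α
        · exact ⟨.inl c, Subtype.ext hα⟩
        · exact absurd ⟨c, hα⟩ v.2
      · obtain ⟨c | c, rfl⟩ := (finSplit h₂).surjective α
        · exact absurd ⟨c.rev, by rw [← hα, hP]; simp only [hlink, Fin.rev_rev]⟩ v.2
        · exact ⟨.inr c, Subtype.ext hα⟩
  have hφ'range : ∀ (v : Q) (l : J'), v ∈ Set.range (φ' l) ↔ v.1 ∈ Set.range (φ l.1) := by
    intro v l
    constructor
    · rintro ⟨a, rfl⟩
      exact ⟨a, rfl⟩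
    · rintro ⟨a, ha⟩
      exact ⟨a, Subtype.ext ha⟩
  have hone : ∀ v ∈ Set.range ψ, ∃ l₀, ∀ l, v ∈ Set.range (φ' l) ↔ l = l₀ := by
    intro v hv
    rw [hψrange] at hv
    have hs := hshared v
    obtain ⟨a₀, b₀, hab, h⟩ := hpair v.1
    simp only [hφ'range, h] at hv hs ⊢
    by_cases ha : a₀ = j ∨ a₀ = j'
    · have hb : b₀ ≠ j ∧ b₀ ≠ j' := by grind
      exact ⟨⟨b₀, hb⟩, fun l => by have := l.2; grind⟩
    · exact ⟨⟨a₀, by tauto⟩, fun l => by have := l.2; grind⟩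
  have htwo : ∀ v ∉ Set.range ψ, ∃ a₀ b₀, a₀ ≠ b₀ ∧
      ∀ l, v ∈ Set.range (φ' l) ↔ l = a₀ ∨ l = b₀ := by
    intro v hv
    rw [hψrange] at hv
    obtain ⟨a₀, b₀, hab, h⟩ := hpair v.1
    simp only [hφ'range, h] at hv ⊢
    exact ⟨⟨a₀, by grind⟩, ⟨b₀, by grind⟩, fun h => hab (congrArg Subtype.val h),
      fun l => by rw [Subtype.ext_iff, Subtype.ext_iff]⟩
  set K := contractionKernel h₁ h₂ (F j) (F j') with hK
  have hKm : AEStronglyMeasurable K volume :=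
    aestronglyMeasurable_contractionKernel h₁ h₂ (hF j) (hF j')
  have hsplit : MeasurePreserving (piSplit X (Equiv.refl (Fin a ⊕ Fin b))) volume volume :=
    measurePreserving_piSplit _
  have hfactor : ∀ (s : Fin p → X) (y : Q → X),
      ∏ l, F l (fun a => (piSplit X e).symm (s, y) (φ l a)) =
        splitKernel h₁ (F j) (fun c => y (ψ (.inl c)), s) *
          splitKernel h₂ (F j') (fun c => s c.rev, fun c => y (ψ (.inr c))) *
          ∏ l : J', F l.1 (fun a => y (φ' l a)) := by
    intro s y
    rw [prod_eq_mul_mul_prod_erase _ hjj]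
    have hx := fun v hv => (congrArg ((piSplit X e).symm (s, y)) (heQ v hv)).trans
      (piSplit_symm_inr e (s, y) ⟨v, hv⟩)
    have hx' := fun c => (congrArg ((piSplit X e).symm (s, y)) (heP c)).trans
      (piSplit_symm_inl e (s, y) c)
    congr 1
    · congr 1
      · rw [splitKernel]
        congr 1
        rw [MeasurableEquiv.eq_symm_apply, piSplit_apply]
        refine Prod.ext ?_ ?_
        · funext c
          exact hx _ (hnotj c)
        · funext c
          exact hx' c
      · rw [splitKernel]
        congr 1
        rw [MeasurableEquiv.eq_symm_apply, piSplit_apply]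
        refine Prod.ext ?_ ?_
        · funext c
          refine Eq.trans ?_ (hx' c.rev)
          simp only [hP, hlink, Fin.rev_rev]
        · funext c
          exact hx _ (hnotj' c)
    · rw [Finset.prod_subtype (p := fun l => l ≠ j ∧ l ≠ j') _ (by simp [and_comm])]
      refine Finset.prod_congr rfl fun l _ => ?_
      congr 1
      funext c
      exact hx _ (hnot l.1 l.2.1 l.2.2 c)
  have hint := integrable_prod_of_paired (X := X) hφ hpair hF
  have hmp := (measurePreserving_piSplit (X := X) e).symm
  have hint' : Integrable (fun z : (Fin p → X) × (Q → X) =>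
      ∏ l, F l (fun a => (piSplit X e).symm z (φ l a))) (volume.prod volume) :=
    (hmp.integrable_comp_emb (MeasurableEquiv.measurableEmbedding _)).2 hint
  -- Only the factors `j` and `j'` depend on the contracted variables; integrating these first
  -- produces `K`.
  have hfub : ∫ x : V → X, ∏ l, F l (fun a => x (φ l a)) =
      ∫ y : Q → X, K (fun c => y (ψ (.inl c)), fun c => y (ψ (.inr c))) *
        ∏ l : J', F l.1 (fun a => y (φ' l a)) := by
    rw [← hmp.integral_comp (MeasurableEquiv.measurableEmbedding _), Measure.volume_eq_prod,
      integral_prod_symm _ hint']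
    refine integral_congr_ae (.of_forall fun y => ?_)
    simp only [hfactor, hK, contractionKernel]
    rw [integral_mul_const]
  rw [hfub]
  calc ‖∫ y : Q → X, K (fun c => y (ψ (.inl c)), fun c => y (ψ (.inr c))) *
        ∏ l : J', F l.1 (fun a => y (φ' l a))‖ₑ
      ≤ ∫⁻ y : Q → X, ‖K (piSplit X (Equiv.refl (Fin a ⊕ Fin b)) (fun c => y (ψ c)))‖ₑ *
        ∏ l : J', ‖F l.1 (fun a => y (φ' l a))‖ₑ := by
        refine (enorm_integral_le_lintegral_enorm _).trans_eq (lintegral_congr fun y => ?_)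
        rw [enorm_mul]
        refine congrArg₂ (· * ·) rfl ?_
        simp only [enorm_eq_nnnorm, nnnorm_prod, ENNReal.ofNNReal_finsetProd]
    _ ≤ (∫⁻ y, ‖K (piSplit X (Equiv.refl (Fin a ⊕ Fin b)) y)‖ₑ ^ 2) ^ (1 / 2 : ℝ) *
        ∏ l : J', (∫⁻ y, ‖F l.1 y‖ₑ ^ 2) ^ (1 / 2 : ℝ) := by
        refine lintegral_mul_prod_le_of_paired (ψ := ψ) (φ := φ')
          (G := fun y => ‖K (piSplit X (Equiv.refl (Fin a ⊕ Fin b)) y)‖ₑ) hψinj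
          (fun l c d h => hφ _ (Subtype.ext_iff.1 h)) hone htwo
          (hKm.comp_measurePreserving hsplit).enorm fun l => (hF l.1).1.enorm
    _ = _ := by
        simp only [rpow_lintegral_sq_eq_eLpNorm]
        rw [Finset.prod_subtype (p := fun l => l ≠ j ∧ l ≠ j')
          ((Finset.univ.erase j).erase j') (by simp [and_comm])]
        congr 1
        exact eLpNorm_comp_measurePreserving hKm hsplit

end PairedIntegrals

/-! ### Combinatorics of non-crossing matchings. -/

section NonCrossingMatchings

/-- A non-crossing perfect matching of `{0, …, N - 1}`, given as a relation. -/
structure IsNCMatching (N : ℕ) (R : ℕ → ℕ → Prop) : Prop where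
  symm : ∀ {x y}, R x y → R y x
  unique : ∀ {x y z}, R x y → R x z → y = z
  irrefl : ∀ x, ¬ R x x
  lt : ∀ {x y}, R x y → x < N
  total : ∀ x < N, ∃ y, R x y
  nonCrossing : ∀ {x₁ y₁ x₂ y₂}, R x₁ y₁ → R x₂ y₂ → x₁ < x₂ → x₂ < y₁ → y₁ < y₂ → False

namespace IsNCMatching

variable {N : ℕ} {R : ℕ → ℕ → Prop}

/-- The partner of a point under an arc stays under it: leaving would cross the arc, and an endpoint
is already taken. -/
theorem exists_between (h : IsNCMatching N R) {x y z : ℕ} (hxy : R x y) (hxz : x < z)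
    (hzy : z < y) : ∃ w, R z w ∧ x < w ∧ w < y := by
  obtain ⟨w, hw⟩ := h.total z (hzy.trans (h.lt (h.symm hxy)))
  refine ⟨w, hw, ?_, ?_⟩
  · rcases lt_trichotomy w x with hlt | rfl | hgt
    · exact (h.nonCrossing (h.symm hw) hxy hlt hxz hzy).elim
    · exact absurd (h.unique hxy (h.symm hw)) hzy.ne'
    · exact hgt
  · rcases lt_trichotomy y w with hlt | rfl | hgt
    · exact (h.nonCrossing hxy hw hxz hzy hlt).elim
    · exact absurd (h.unique (h.symm hxy) (h.symm hw)) hxz.ne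
    · exact hgt

/-- Descent on the length of an arc: if `x` and `y` are not adjacent, the arc at `x + 1` lies
strictly inside. -/
theorem exists_adjacent (h : IsNCMatching N R) (hN : 0 < N) : ∃ z, R z (z + 1) := by
  have key : ∀ k x y, y = x + 1 + k → R x y → ∃ z, R z (z + 1) := by
    intro k
    induction k using Nat.strong_induction_on with
    | _ k ih =>
      intro x y hy hxy
      rcases Nat.eq_zero_or_pos k with rfl | hk
      · exact ⟨x, by simpa [hy] using hxy⟩
      · obtain ⟨w, hw, hxw, hwy⟩ := h.exists_between hxy (lt_add_one x) (by omega)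
        have hne : w ≠ x + 1 := fun e => h.irrefl _ (e ▸ hw)
        exact ih (w - (x + 1) - 1) (by omega) (x + 1) w (by omega) hw
  obtain ⟨y, hy⟩ := h.total 0 hN
  have hne : y ≠ 0 := fun e => h.irrefl _ (e ▸ hy)
  exact key (y - 1) 0 y (by omega) hy

/-- The pairs joining two adjacent intervals, neither of which contains a pair, are nested. -/
theorem nested (h : IsNCMatching N R) {lo c hi : ℕ}
    (hleft : ∀ x y, lo ≤ x → x < c → lo ≤ y → y < c → ¬ R x y)
    (hright : ∀ x y, c ≤ x → x < hi → c ≤ y → y < hi → ¬ R x y) {x y : ℕ} (hx : lo ≤ x)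
    (hxc : x < c) (hcy : c ≤ y) (hy : y < hi) (hxy : R x y) :
    x + y + 1 = 2 * c ∧ ∀ t, c + t ≤ y → R (c - 1 - t) (c + t) := by
  induction hk : y - x using Nat.strong_induction_on generalizing x y with
  | _ k ih =>
    -- The partner of `x + 1` lies under the arc but not in the left interval, so it lies in the
    -- right one and induction applies; `hr` treats `y - 1` symmetrically.
    have hl : x + 1 < c → ∃ w, w < y ∧ c ≤ w ∧ (x + 1) + w + 1 = 2 * c ∧
        ∀ t, c + t ≤ w → R (c - 1 - t) (c + t) := by
      intro hlt
      obtain ⟨w, hw, hxw, hwy⟩ := h.exists_between hxy (lt_add_one x) (by omega)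
      have hcw : c ≤ w := by
        by_contra hcw
        exact hleft (x + 1) w (by omega) hlt (by omega) (by omega) hw
      exact ⟨w, hwy, hcw, ih (w - (x + 1)) (by omega) (by omega) hlt hcw (by omega) hw rfl⟩
    have hr : c < y → ∃ w, x < w ∧ w + (y - 1) + 1 = 2 * c := by
      intro hlt
      obtain ⟨w, hw, hxw, hwy⟩ := h.exists_between hxy (z := y - 1) (by omega) (by omega)
      have hcw : w < c := by
        by_contra hcw
        exact hright (y - 1) w (by omega) (by omega) (by omega) (by omega) hw
      exact ⟨w, hxw, (ih (y - 1 - w) (by omega) (by omega) hcw (by omega) (by omega)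
        (h.symm hw) rfl).1⟩
    -- The arc at `x + 1` yields `x + y + 1 ≥ 2 * c`, the arc at `y - 1` the reverse inequality. If
    -- one endpoint touches the boundary, so must the other.
    have heq : x + y + 1 = 2 * c := by
      by_cases h1 : x + 1 < c
      · obtain ⟨w, hw, hw', hw2, -⟩ := hl h1
        by_cases h2 : c < y
        · obtain ⟨v, hv, hv2⟩ := hr h2
          omega
        · omega
      · by_cases h2 : c < y
        · obtain ⟨v, hv, hv2⟩ := hr h2
          omega
        · omega
    refine ⟨heq, fun t ht => ?_⟩
    rcases eq_or_lt_of_le ht with hty | hty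
    · have e : c - 1 - t = x := by omega
      rw [e, hty]
      exact hxy
    · obtain ⟨w, hw, hw', hw2, hw3⟩ := hl (by omega)
      exact hw3 t (by omega)

end IsNCMatching

end NonCrossingMatchings

/-! ### From pairings of tensor blocks to nested pairs between neighbours. -/

namespace WignerChaos

section Blocks

variable {r : ℕ} {m : Fin r → ℕ} {π : Finpartition (Finset.univ : Finset (Fin (∑ j, m j)))}

/-- The first position of the block with index `k`. -/
def blockStart (m : Fin r → ℕ) (k : ℕ) : ℕ :=
  ∑ i ∈ Finset.range k, if h : i < r then m ⟨i, h⟩ else 0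

theorem blockStart_succ (m : Fin r → ℕ) (j : Fin r) :
    blockStart m (j + 1) = blockStart m j + m j := by
  simp [blockStart, Finset.sum_range_succ]

theorem blockStart_mono (m : Fin r → ℕ) : Monotone (blockStart m) := fun _ _ h =>
  Finset.sum_le_sum_of_subset (Finset.range_mono h)

theorem val_finSigmaFinEquiv (j : Fin r) (a : Fin (m j)) :
    ((finSigmaFinEquiv ⟨j, a⟩ : Fin (∑ j, m j)) : ℕ) = blockStart m j + a := by
  rw [finSigmaFinEquiv_apply, blockStart, ← Fin.sum_univ_eq_sum_range]
  congr 1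
  refine Finset.sum_congr rfl fun i _ => ?_
  rw [dif_pos (i.2.trans j.2)]
  rfl

theorem exists_eq_blockStart_add {x : ℕ} (hx : x < ∑ j, m j) :
    ∃ (j : Fin r) (a : Fin (m j)), x = blockStart m j + a ∧ finSigmaFinEquiv ⟨j, a⟩ = ⟨x, hx⟩ := by
  obtain ⟨⟨j, a⟩, h⟩ := finSigmaFinEquiv.surjective (⟨x, hx⟩ : Fin (∑ j, m j))
  exact ⟨j, a, by rw [← val_finSigmaFinEquiv, h], h⟩

/-- The block of `π` containing the `a`-th position of the `j`-th block. -/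
def blockVar (π : Finpartition (Finset.univ : Finset (Fin (∑ j, m j)))) (j : Fin r)
    (a : Fin (m j)) : π.parts :=
  ⟨π.part (finSigmaFinEquiv ⟨j, a⟩), π.part_mem.2 (Finset.mem_univ _)⟩

theorem Respects.not_part_eq (h : Respects m π) {j : Fin r} {a b : Fin (m j)} (hab : a ≠ b) :
    π.part (finSigmaFinEquiv ⟨j, a⟩) ≠ π.part (finSigmaFinEquiv ⟨j, b⟩) := by
  intro e
  have h1 := h _ (π.part_mem.2 (Finset.mem_univ (finSigmaFinEquiv ⟨j, a⟩))) j
  refine hab ?_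
  have := Finset.card_le_one.1 h1 (finSigmaFinEquiv ⟨j, a⟩)
    (by simp [tensorBlock, π.mem_part]) (finSigmaFinEquiv ⟨j, b⟩)
    (by rw [e]; simp [tensorBlock, π.mem_part])
  simpa using this

theorem blockVar_injective (h : Respects m π) (j : Fin r) :
    Function.Injective (blockVar π j) := fun a b hab => by
  by_contra hne
  exact h.not_part_eq hne (Subtype.ext_iff.1 hab)

/-- This is the sharing hypothesis of the analytic estimates: the two elements of a block of `π` lie
in two intervals, distinct because `π` respects them. -/
theorem exists_blockVar_eq_iff (hp : IsPairing π) (h : Respects m π) (v : π.parts) :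
    ∃ a b, a ≠ b ∧ ∀ j, v ∈ Set.range (blockVar π j) ↔ j = a ∨ j = b := by
  obtain ⟨B, hB⟩ := v
  obtain ⟨x, y, hxy, rfl⟩ := Finset.card_eq_two.1 (hp B hB)
  obtain ⟨⟨a, α⟩, rfl⟩ := finSigmaFinEquiv.surjective x
  obtain ⟨⟨b, β⟩, rfl⟩ := finSigmaFinEquiv.surjective y
  have hx := π.part_eq_of_mem hB (Finset.mem_insert_self _ _)
  have hy := π.part_eq_of_mem hB (Finset.mem_insert_of_mem (Finset.mem_singleton_self _))
  refine ⟨a, b, ?_, fun j => ⟨?_, ?_⟩⟩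
  · rintro rfl
    refine h.not_part_eq (fun e => hxy (by rw [e])) (hx.trans hy.symm)
  · rintro ⟨γ, hγ⟩
    have hmem : finSigmaFinEquiv ⟨j, γ⟩ ∈ π.part (finSigmaFinEquiv ⟨j, γ⟩) :=
      π.mem_part (Finset.mem_univ _)
    rw [show π.part (finSigmaFinEquiv ⟨j, γ⟩) = _ from Subtype.ext_iff.1 hγ] at hmem
    simp only [Finset.mem_insert, Finset.mem_singleton, EmbeddingLike.apply_eq_iff_eq,
      Sigma.mk.injEq] at hmem
    exact hmem.imp (·.1) (·.1)
  · rintro (rfl | rfl)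
    · exact ⟨α, Subtype.ext hx⟩
    · exact ⟨β, Subtype.ext hy⟩

/-- Two distinct positions are paired by `π`. -/
def Paired {N : ℕ} (π : Finpartition (Finset.univ : Finset (Fin N))) (x y : ℕ) : Prop :=
  ∃ (hx : x < N) (hy : y < N), x ≠ y ∧ π.part ⟨x, hx⟩ = π.part ⟨y, hy⟩

theorem IsPairing.isNCMatching {N : ℕ} {π : Finpartition (Finset.univ : Finset (Fin N))}
    (hp : IsPairing π) (hnc : NonCrossing π) : IsNCMatching N (Paired π) where
  symm := fun ⟨hx, hy, hne, h⟩ => ⟨hy, hx, hne.symm, h.symm⟩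
  unique := by
    rintro x y z ⟨hx, hy, hne, h⟩ ⟨_, hz, hne', h'⟩
    by_contra hyz
    have hB := π.part_mem.2 (Finset.mem_univ (⟨x, hx⟩ : Fin N))
    have hsub : ({⟨x, hx⟩, ⟨y, hy⟩, ⟨z, hz⟩} : Finset (Fin N)) ⊆ π.part ⟨x, hx⟩ := by
      intro w hw
      simp only [Finset.mem_insert, Finset.mem_singleton] at hw
      rcases hw with rfl | rfl | rfl
      · exact π.mem_part (Finset.mem_univ _)
      · rw [h]; exact π.mem_part (Finset.mem_univ _)
      · rw [h']; exact π.mem_part (Finset.mem_univ _)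
    have := Finset.card_le_card hsub
    rw [hp _ hB, Finset.card_eq_three.2 ⟨_, _, _, by simpa using hne, by simpa using hne',
      by simpa using hyz, rfl⟩] at this
    omega
  irrefl := fun x ⟨_, _, h, _⟩ => h rfl
  lt := fun ⟨hx, _⟩ => hx
  total := by
    intro x hx
    have hB := π.part_mem.2 (Finset.mem_univ (⟨x, hx⟩ : Fin N))
    obtain ⟨y, hy, hne⟩ := Finset.exists_mem_ne (by rw [hp _ hB]; norm_num) (⟨x, hx⟩ : Fin N)
    exact ⟨y, hx, y.2, fun e => hne (Fin.ext e.symm), (π.part_eq_of_mem hB hy).symm⟩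
  nonCrossing := by
    rintro x₁ y₁ x₂ y₂ ⟨hx₁, hy₁, hne₁, h₁⟩ ⟨hx₂, hy₂, hne₂, h₂⟩ h12 h21 h22
    -- `NonCrossing` only concerns distinct blocks; if the blocks coincide, one block has three
    -- elements.
    by_cases e : π.part ⟨x₁, hx₁⟩ = π.part ⟨x₂, hx₂⟩
    · have hB := π.part_mem.2 (Finset.mem_univ (⟨x₁, hx₁⟩ : Fin N))
      have hsub : ({⟨x₁, hx₁⟩, ⟨x₂, hx₂⟩, ⟨y₁, hy₁⟩} : Finset (Fin N)) ⊆ π.part ⟨x₁, hx₁⟩ := by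
        intro w hw
        simp only [Finset.mem_insert, Finset.mem_singleton] at hw
        rcases hw with rfl | rfl | rfl
        · exact π.mem_part (Finset.mem_univ _)
        · rw [e]; exact π.mem_part (Finset.mem_univ _)
        · rw [h₁]; exact π.mem_part (Finset.mem_univ _)
      have := Finset.card_le_card hsub
      rw [hp _ hB, Finset.card_eq_three.2 ⟨_, _, _, by simpa using h12.ne, by simpa using hne₁,
        by simpa using h21.ne, rfl⟩] at this
      omega
    · exact hnc _ (π.part_mem.2 (Finset.mem_univ _)) _ (π.part_mem.2 (Finset.mem_univ _)) e
        ⟨⟨x₁, hx₁⟩, π.mem_part (Finset.mem_univ _), ⟨y₁, hy₁⟩,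
          h₁ ▸ π.mem_part (Finset.mem_univ _), ⟨x₂, hx₂⟩, π.mem_part (Finset.mem_univ _),
          ⟨y₂, hy₂⟩, h₂ ▸ π.mem_part (Finset.mem_univ _), h12, h21, h22⟩

theorem Respects.not_paired (h : Respects m π) {j : Fin r} {x y : ℕ}
    (hx : blockStart m j ≤ x) (hx' : x < blockStart m (j + 1)) (hy : blockStart m j ≤ y)
    (hy' : y < blockStart m (j + 1)) : ¬ Paired π x y := by
  rintro ⟨hxN, hyN, hne, e⟩
  rw [blockStart_succ] at hx' hy'
  have e1 : finSigmaFinEquiv ⟨j, ⟨x - blockStart m j, by omega⟩⟩ = (⟨x, hxN⟩ : Fin (∑ j, m j)) :=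
    Fin.ext (by rw [val_finSigmaFinEquiv]; simp; omega)
  have e2 : finSigmaFinEquiv ⟨j, ⟨y - blockStart m j, by omega⟩⟩ = (⟨y, hyN⟩ : Fin (∑ j, m j)) :=
    Fin.ext (by rw [val_finSigmaFinEquiv]; simp; omega)
  rw [← e1, ← e2] at e
  exact h.not_part_eq (by simp; omega) e

theorem paired_iff_blockVar_eq {j l : Fin r} (hjl : j ≠ l) (a : Fin (m j)) (b : Fin (m l)) :
    Paired π (blockStart m j + a) (blockStart m l + b) ↔ blockVar π j a = blockVar π l b := by
  have e1 := val_finSigmaFinEquiv j a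
  have e2 := val_finSigmaFinEquiv l b
  constructor
  · rintro ⟨hx, hy, -, h⟩
    refine Subtype.ext ?_
    have e3 : finSigmaFinEquiv ⟨j, a⟩ = (⟨_, hx⟩ : Fin (∑ j, m j)) := Fin.ext e1
    have e4 : finSigmaFinEquiv ⟨l, b⟩ = (⟨_, hy⟩ : Fin (∑ j, m j)) := Fin.ext e2
    simp only [blockVar, e3, e4, h]
  · intro h
    rw [← e1, ← e2]
    refine ⟨Fin.is_lt _, Fin.is_lt _, ?_, Subtype.ext_iff.1 h⟩
    intro e
    have := finSigmaFinEquiv.injective (Fin.ext e)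
    exact hjl (congrArg Sigma.fst this)

theorem exists_paired_of_adj {j k : Fin r} (h : (linkGraph m π).Adj j k) :
    ∃ (a : Fin (m j)) (b : Fin (m k)), blockVar π j a = blockVar π k b := by
  have key : ∀ j k, Links m π j k →
      ∃ (a : Fin (m j)) (b : Fin (m k)), blockVar π j a = blockVar π k b := by
    rintro j k ⟨x, hx, y, hy, hB⟩
    simp only [tensorBlock, Finset.mem_image, Finset.mem_univ, true_and] at hx hy
    obtain ⟨a, rfl⟩ := hx
    obtain ⟨b, rfl⟩ := hy
    exact ⟨a, b, Subtype.ext ((π.part_eq_of_mem hB (Finset.mem_insert_self _ _)).trans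
      (π.part_eq_of_mem hB (Finset.mem_insert_of_mem (Finset.mem_singleton_self _))).symm)⟩
  rcases ((SimpleGraph.fromRel_adj _ _ _).1 h).2 with h | h
  · exact key j k h
  · obtain ⟨a, b, hab⟩ := key k j h
    exact ⟨b, a, hab.symm⟩

/-- In a connected non-crossing pairing of at least three blocks some two adjacent blocks are
joined by nested pairs which do not exhaust both of them. -/
theorem IsConnectedNCPairing.exists_nested (hπ : IsConnectedNCPairing m π) (hm : ∀ j, 1 ≤ m j)
    (hr : 3 ≤ r) :
    ∃ (j j' : Fin r) (a b p : ℕ) (h₁ : a + p = m j) (h₂ : p + b = m j'), j ≠ j' ∧ 1 ≤ p ∧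
      (1 ≤ a ∨ 1 ≤ b) ∧
      (∀ c : Fin p, blockVar π j (finSplit h₁ (.inr c)) =
        blockVar π j' (finSplit h₂ (.inl c.rev))) ∧
      ∀ α β, blockVar π j α = blockVar π j' β → (β : ℕ) < p := by
  have hM := hπ.pairing.isNCMatching hπ.nonCrossing
  have hN : 0 < ∑ j, m j := lt_of_lt_of_le (hm ⟨0, by omega⟩)
    (Finset.single_le_sum (f := m) (fun _ _ => Nat.zero_le _) (Finset.mem_univ _))
  obtain ⟨z, hz⟩ := hM.exists_adjacent hN
  obtain ⟨j, α, hα, -⟩ := exists_eq_blockStart_add (m := m) (hM.lt hz)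
  obtain ⟨l, β, hβ, -⟩ := exists_eq_blockStart_add (m := m) (hM.lt (hM.symm hz))
  have hsj := blockStart_succ m j
  have hsl := blockStart_succ m l
  have hα' := α.2
  have hβ' := β.2
  have hjl : j ≠ l := by
    rintro rfl
    exact hπ.respects.not_paired (j := j) (by omega) (by omega) (by omega) (by omega) hz
  have hlt : j < l := by
    rcases lt_or_gt_of_ne hjl with h | h
    · exact h
    · have := blockStart_mono m (show (l : ℕ) + 1 ≤ j from h)
      omega
  -- The positions `z` and `z + 1` are adjacent and no interval is empty, so none fits in between.
  have hl : (l : ℕ) = j + 1 := by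
    have h1 : (j : ℕ) + 1 < r := lt_of_le_of_lt hlt l.2
    have h2 := blockStart_succ m ⟨j + 1, h1⟩
    have h3 := hm ⟨j + 1, h1⟩
    simp only at h2
    by_contra hne
    have h4 := blockStart_mono m (show (j : ℕ) + 1 + 1 ≤ l by have := Fin.lt_def.1 hlt; omega)
    omega
  rw [hl] at hsl hβ
  set lo := blockStart m j with hlo
  set c := blockStart m (j + 1) with hc
  set hi := blockStart m (j + 1 + 1) with hhi
  have hzc : z + 1 = c := by omega
  have hleft : ∀ x y, lo ≤ x → x < c → lo ≤ y → y < c → ¬ Paired π x y :=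
    fun x y h1 h2 h3 h4 => hπ.respects.not_paired (j := j) h1 h2 h3 h4
  have hright : ∀ x y, c ≤ x → x < hi → c ≤ y → y < hi → ¬ Paired π x y := by
    intro x y h1 h2 h3 h4
    rw [hc, ← hl] at h1 h3
    rw [hhi, ← hl] at h2 h4
    exact hπ.respects.not_paired (j := l) h1 h2 h3 h4
  -- Level `t` is the pair symmetric about the boundary, `c - 1 - t` with `c + t`. The left interval
  -- has only `c - lo` levels, so some level fails; the first failure is `p`.
  have hex : ∃ t, ¬ (lo + t < c ∧ c + t < hi ∧ Paired π (c - 1 - t) (c + t)) :=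
    ⟨c - lo, by omega⟩
  classical
  set p := Nat.find hex with hp
  have hlow : ∀ t < p, lo + t < c ∧ c + t < hi ∧ Paired π (c - 1 - t) (c + t) := fun t ht =>
    not_not.1 (Nat.find_min hex ht)
  have hspec := Nat.find_spec hex
  have hp1 : 1 ≤ p := by
    by_contra h0
    have h0 : p = 0 := by omega
    rw [← hp, h0] at hspec
    refine hspec ⟨by omega, by have := hm l; omega, ?_⟩
    rw [show c - 1 - 0 = z by omega, show c + 0 = z + 1 by omega]
    exact hz
  have hple := hlow (p - 1) (by omega)
  have hpaired : ∀ (α : Fin (m j)) (β : Fin (m l)), Paired π (lo + α) (c + β) ↔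
      blockVar π j α = blockVar π l β := by
    intro α β
    rw [← paired_iff_blockVar_eq hjl, hl]
  refine ⟨j, l, m j - p, m l - p, p, by omega, by omega, hjl, hp1, ?_, ?_, ?_⟩
  -- If both intervals were exhausted, `{j, l}` would be closed under adjacency in the link graph,
  -- hence all of it by connectedness, against `3 ≤ r`.
  · by_contra hfull
    have hpj : p = m j := by omega
    have hpl : p = m l := by omega
    have hfull' : ∀ t < p, ∃ (α : Fin (m j)) (β : Fin (m l)), (α : ℕ) = p - 1 - t ∧
        (β : ℕ) = t ∧ blockVar π j α = blockVar π l β := by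
      intro t ht
      refine ⟨⟨p - 1 - t, by omega⟩, ⟨t, by omega⟩, rfl, rfl, ?_⟩
      rw [← hpaired]
      have := (hlow t ht).2.2
      rwa [show c - 1 - t = lo + (p - 1 - t) by omega] at this
    have hclosed : ∀ k k', (k = j ∨ k = l) → (linkGraph m π).Adj k k' → (k' = j ∨ k' = l) := by
      intro k k' hk hadj
      obtain ⟨a, b, hab⟩ := exists_paired_of_adj hadj
      obtain ⟨a₀, b₀, -, hv⟩ :=
        exists_blockVar_eq_iff hπ.pairing hπ.respects (blockVar π k a)
      have hk1 := (hv k).1 ⟨a, rfl⟩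
      have hk2 := (hv k').1 ⟨b, hab.symm⟩
      have hne := hadj.ne
      have hjl2 : (j = a₀ ∨ j = b₀) ∧ (l = a₀ ∨ l = b₀) := by
        rcases hk with rfl | rfl
        · obtain ⟨α, β, hα, -, h⟩ := hfull' (p - 1 - a) (by omega)
          have : α = a := Fin.ext (by have := a.2; omega)
          subst this
          exact ⟨hk1, (hv l).1 ⟨β, h.symm⟩⟩
        · obtain ⟨α, β, -, hβ, h⟩ := hfull' a (by have := a.2; omega)
          have : β = a := Fin.ext hβ
          subst this
          exact ⟨(hv j).1 ⟨α, h⟩, hk1⟩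
      grind
    have hall : ∀ k, k = j ∨ k = l := by
      intro k
      have hreach := (SimpleGraph.reachable_iff_reflTransGen _ _).1 (hπ.connected.preconnected j k)
      induction hreach with
      | refl => exact Or.inl rfl
      | tail _ hadj ih => exact hclosed _ _ ih hadj
    have h0 := hall ⟨0, by omega⟩
    have h1 := hall ⟨1, by omega⟩
    have h2 := hall ⟨2, by omega⟩
    simp only [Fin.ext_iff] at h0 h1 h2
    omega
  · intro d
    rw [← hpaired]
    have := (hlow d.rev d.rev.2).2.2
    convert this using 1
    · have hd := d.2
      simp [finSplit, Fin.val_rev]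
      omega
    · simp [finSplit]
  · intro α β h
    rw [← hpaired] at h
    have hα := α.2
    have hβ := β.2
    by_contra hge
    -- A pair reaching offset `p` or beyond would have the level `p` pair nested beneath it or equal
    -- to it, but level `p` fails.
    obtain ⟨hsum, hnest⟩ := hM.nested hleft hright (by omega) (by omega) (by omega) (by omega) h
    exact hspec ⟨by omega, by omega, hnest _ (by omega)⟩

end Blocks

end WignerChaos

/-! ### Passage to the limit. -/

theorem ENNReal.tendsto_zero_of_sq_le {u v : ℕ → ℝ≥0∞} {C : ℝ≥0∞} (hC : C ≠ ∞)
    (h : ∀ k, u k ^ 2 ≤ v k * C) (hv : Tendsto v atTop (𝓝 0)) : Tendsto u atTop (𝓝 0) := by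
  have h1 : Tendsto (fun k => (v k * C) ^ (1 / 2 : ℝ)) atTop (𝓝 0) := by
    have h2 := ENNReal.Tendsto.mul_const hv (Or.inr hC)
    have h3 := (ENNReal.continuous_rpow_const (y := (1 / 2 : ℝ))).tendsto (0 * C) |>.comp h2
    simpa [Function.comp_def] using h3
  refine tendsto_of_tendsto_of_tendsto_of_le_of_le tendsto_const_nhds h1 (fun _ => zero_le) ?_
  intro k
  calc u k = (u k ^ 2) ^ (1 / 2 : ℝ) := by
        rw [← ENNReal.rpow_natCast, ← ENNReal.rpow_mul]
        norm_num
    _ ≤ (v k * C) ^ (1 / 2 : ℝ) := by gcongr; exact h k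

theorem proposition3p1 (d : ℕ) (hd : 2 ≤ d) (n : Fin d → ℕ) (hn : ∀ i, 1 ≤ n i)
    (f : ∀ i : Fin d, ℕ → (Fin (n i) → ℝ≥0) → ℂ)
    (hL2 : ∀ i k, MemLp (f i k) 2 volume)
    (hmirror : ∀ i k, WignerChaos.MirrorSymmetric (f i k))
    (M : ℝ) (hM : 0 < M)
    (hbound : ∀ i k, eLpNorm (f i k) 2 volume ≤ ENNReal.ofReal M)
    (hcontr : ∀ (i : Fin d) (p : ℕ), 1 ≤ p → ∀ hp : p < n i,
      Tendsto (fun k => eLpNorm (WignerChaos.contraction p hp.le hp.le (f i k) (f i k)) 2 volume)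
        atTop (𝓝 0))
    (r : ℕ) (hr : 3 ≤ r) (i : Fin r → Fin d)
    (π : Finpartition (Finset.univ : Finset (Fin (∑ j, n (i j)))))
    (hπ : WignerChaos.IsConnectedNCPairing (fun j => n (i j)) π) :
    (∀ k, WignerChaos.PairingIntegrable π (WignerChaos.tensor fun j => f (i j) k)) ∧
      Tendsto (fun k => WignerChaos.pairingIntegral π (WignerChaos.tensor fun j => f (i j) k))
        atTop (𝓝 0) := by
  have hinj := WignerChaos.blockVar_injective hπ.respects
  have hpair := WignerChaos.exists_blockVar_eq_iff hπ.pairing hπ.respects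
  -- `tensor` evaluated at `diagonalPoint` is by definition the product of the factors composed with
  -- `blockVar`.
  refine ⟨fun k => integrable_prod_of_paired hinj hpair fun j => hL2 (i j) k, ?_⟩
  obtain ⟨j, j', a, b, p, h₁, h₂, hjj, hp, hab, hlink, hmax⟩ :=
    hπ.exists_nested (fun j => hn (i j)) hr
  set C := ENNReal.ofReal M with hC
  have hCtop : C ≠ ∞ := ENNReal.ofReal_ne_top
  have hK : Tendsto (fun k => eLpNorm (contractionKernel h₁ h₂ (f (i j) k) (f (i j') k)) 2 volume)
      atTop (𝓝 0) := by
    -- The factor with variables left over supplies the vanishing self-contraction, of order `a` or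
    -- `b`, which is less than its number of variables because `p ≥ 1`; the other is bounded by `M`.
    rcases hab with ha | hb
    · refine ENNReal.tendsto_zero_of_sq_le (ENNReal.pow_ne_top (n := 2) hCtop) (fun k => ?_)
        (hcontr (i j) a ha (by omega))
      rw [WignerChaos.eLpNorm_contraction ((add_comm p a).trans h₁) h₁ _ _ (hL2 _ k) (hL2 _ k)]
      refine (eLpNorm_contractionKernel_sq_le_left h₁ ((add_comm p a).trans h₁) h₂ (hL2 _ k)
        (hL2 _ k) (hmirror (i j) k)).trans ?_
      gcongr
      exact hbound (i j') k
    · refine ENNReal.tendsto_zero_of_sq_le (ENNReal.pow_ne_top (n := 2) hCtop) (fun k => ?_)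
        (hcontr (i j') b hb (by omega))
      rw [WignerChaos.eLpNorm_contraction h₂ ((add_comm b p).trans h₂) _ _ (hL2 _ k) (hL2 _ k)]
      refine (eLpNorm_contractionKernel_sq_le_right h₁ h₂ ((add_comm b p).trans h₂) (hL2 _ k)
        (hL2 _ k) (hmirror (i j') k)).trans ?_
      gcongr
      exact hbound (i j) k
  rw [tendsto_zero_iff_enorm_tendsto_zero]
  have hlim := ENNReal.Tendsto.mul_const (b := ∏ _l ∈ (Finset.univ.erase j).erase j', C) hK
    (Or.inr (ENNReal.prod_lt_top fun _ _ => hCtop.lt_top).ne)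
  rw [zero_mul] at hlim
  refine tendsto_of_tendsto_of_tendsto_of_le_of_le tendsto_const_nhds hlim (fun _ => zero_le) ?_
  intro k
  refine (enorm_integral_prod_le hinj hpair (fun l => hL2 (i l) k) hjj h₁ h₂ hlink hmax).trans ?_
  exact mul_le_mul' le_rfl (Finset.prod_le_prod' fun l _ => hbound (i l) k)
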